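/- Let $\mathcal C$ be a Grothendieck category, and let $(\mathcal E,\mathcal T,\mathcal F)$ be a TTF triple of finite type in $\mathcal C$: $(\mathcal E,\mathcal T)$ and $(\mathcal T,\mathcal F)$ are torsion pairs in $\mathcal C$, and $\mathcal F$ is closed under direct limits. Terminology. A direct limit is a colimit of a direct system, i.e. of a functor on a (small, non-empty) directed poset. A torsion pair in $\mathcal C$ is a pair $(\mathcal X,\mathcal Y)$ of full subcategories, closed under isomorphisms, such that $\operatorname{Hom}_{\mathcal C}(X,Y)=0$ for all $X\in\mathcal X$, $Y\in\mathcal Y$, and every object $M$ of $\mathcal C$ admits a short exact sequence $0\to x(M)\to M\to y(M)\to 0$ with $x(M)\in\mathcal X$ and $y(M)\in\mathcal Y$ (unique up to isomorphism). Let $\mathcal A$ be an additive category with kernels and direct limits. An object $B$ of $\mathcal A$ is finitely presented if $\operatorname{Hom}_{\mathcal A}(B,-)$ commutes with direct limits; $\operatorname{fp}(\mathcal A)$ is the full subcategory of these objects. The category $\mathcal A$ is locally finitely presented if $\operatorname{fp}(\mathcal A)$ is skeletally small and every object of $\mathcal A$ is the direct limit of a direct system in $\operatorname{fp}(\mathcal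 A)$; it is quasi locally coherent if moreover $\operatorname{fp}(\mathcal A)$ is closed under taking kernels in $\mathcal A$. An abelian category $\mathcal A$ is locally coherent if it is locally finitely presented and $\operatorname{fp}(\mathcal A)$ is an abelian category. Consider the following statements: (a) $\mathcal C$ is locally coherent. (b) The following three conditions hold: (i) $\mathcal E$ and $\mathcal T$ are quasi locally coherent; (ii) for every $P\in\operatorname{fp}(\mathcal E)$, the functor $\operatorname{Ext}^1_{\mathcal C}(P,-)$ commutes with direct limits of direct systems of objects of $\mathcal T$; (iii) for every $Q\in\operatorname{fp}(\mathcal T)$, the functor $\operatorname{Ext}^1_{\mathcal C}(Q,-)$ commutes with direct limits of direct systems of objects of $\mathcal E$. (c) Conditions (i) and (ii) hold, and moreover (iii)$'$ the torsion pair $(\mathcal E,\mathcal T)$ restricts to $\operatorname{fp}(\mathcal C)$: if $B\in\operatorname{fp}(\mathcal C)$ and $0\to x(B)\to B\to y(B)\to 0$ is the sequence above with $x(B)\in\mathcal E$ and $y(B)\in\mathcal T$, then $x(B),y(B)\in\operatorname{fp}(\mathcal C)$. Then (a) $\Leftrightarrow$ (b) and (b) $\Rightarrow$ (c). If $\mathcal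 C$ is locally finitely presented, then (a), (b) and (c) are equivalent. -/

import Mathlib

open CategoryTheory CategoryTheory.Limits

universe w v u

namespace LCTTF

/-! ## Finiteness conditions on additive categories

The finitely presented objects of a category `A` are Mathlib's
`ObjectProperty.isFinitelyPresentable.{w} A`: the objects `B` such that `Hom(B, -)` preserves
`w`-small filtered colimits. A direct system is a functor out of a nonempty directed poset. -/

/-- Locally finitely presented categories: additive categories with kernels and direct limits
whose finitely presented objects form a skeletally small subcategory, and in which every object
is a direct limit of a direct system of finitely presented objects. -/
structure IsLocallyFinitelyPresented (A : Type u) [Category.{v} A] [Preadditive A] : Prop where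
  hasFiniteBiproducts : HasFiniteBiproducts A
  hasKernels : HasKernels A
  hasDirectLimits : ∀ (J : Type w) [PartialOrder J] [IsDirectedOrder J] [Nonempty J],
    HasColimitsOfShape J A
  essentiallySmall_fp :
    ObjectProperty.EssentiallySmall.{w} (ObjectProperty.isFinitelyPresentable.{w} A)
  exists_directLimit : ∀ X : A, ∃ (J : Type w) (_ : PartialOrder J) (_ : IsDirectedOrder J)
    (_ : Nonempty J), (ObjectProperty.isFinitelyPresentable.{w} A).colimitsOfShape J X

/-- Quasi locally coherent categories: locally finitely presented, and the finitely presented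
objects are closed under the kernels of the category. -/
structure IsQuasiLocallyCoherent (A : Type u) [Category.{v} A] [Preadditive A] : Prop where
  isLocallyFinitelyPresented : IsLocallyFinitelyPresented.{w} A
  isClosedUnderKernels : (ObjectProperty.isFinitelyPresentable.{w} A).IsClosedUnderKernels

/-- Locally coherent abelian categories: locally finitely presented, and the full subcategory of
finitely presented objects is an abelian category. -/
structure IsLocallyCoherent (A : Type u) [Category.{v} A] [Abelian A] : Prop where
  isLocallyFinitelyPresented : IsLocallyFinitelyPresented.{w} A
  abelian_fp : Nonempty (Abelian (ObjectProperty.isFinitelyPresentable.{w} A).FullSubcategory)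

/-! ## Torsion pairs and TTF triples -/

section Torsion

variable {C : Type u} [Category.{v} C] [Abelian C]

/-- The sequence `0 ⟶ X ⟶ M ⟶ Y ⟶ 0` given by `i` and `p` is exact, with `X` in `T` and `Y`
in `F`. -/
def IsApproximation (T F : ObjectProperty C) {X M Y : C} (i : X ⟶ M) (p : M ⟶ Y) : Prop :=
  T X ∧ F Y ∧ ∃ h : i ≫ p = 0, (ShortComplex.mk i p h).ShortExact

/-- Torsion pairs `(T, F)` of (replete) full subcategories of an abelian category. -/
structure IsTorsionPair (T F : ObjectProperty C) : Prop where
  isClosedUnderIsomorphisms_left : T.IsClosedUnderIsomorphisms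
  isClosedUnderIsomorphisms_right : F.IsClosedUnderIsomorphisms
  hom_eq_zero : ∀ ⦃X Y : C⦄, T X → F Y → ∀ f : X ⟶ Y, f = 0
  exists_approximation : ∀ M : C, ∃ (X Y : C) (i : X ⟶ M) (p : M ⟶ Y), IsApproximation T F i p

/-- `P` is closed under the direct limits of `C`. -/
def IsClosedUnderDirectLimits (P : ObjectProperty C) : Prop :=
  ∀ (J : Type w) [PartialOrder J] [IsDirectedOrder J] [Nonempty J],
    P.IsClosedUnderColimitsOfShape J

/-- `(E, T, F)` is a TTF triple of finite type: `(E, T)` and `(T, F)` are torsion pairs and the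
torsionfree class `F` of the latter is closed under direct limits. -/
structure IsTTFTripleOfFiniteType (E T F : ObjectProperty C) : Prop where
  left : IsTorsionPair E T
  right : IsTorsionPair T F
  finiteType : IsClosedUnderDirectLimits.{w} F

/-- The torsion pair `(T, F)` restricts to the finitely presented objects: if `B` is finitely
presented, so are its torsion part and its torsionfree part (these are determined by `B` up to
isomorphism as the outer terms of the approximation sequence of `B`). -/
def RestrictsToFP (T F : ObjectProperty C) : Prop :=
  ∀ ⦃X B Y : C⦄ (i : X ⟶ B) (p : B ⟶ Y), IsApproximation T F i p →
    IsFinitelyPresentable.{w} B → IsFinitelyPresentable.{w} X ∧ IsFinitelyPresentable.{w} Y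

/-- For every finitely presented object `P` of the category `S`, the functor `Ext¹_C(P, -)`
commutes with the direct limits of direct systems of objects of `S'`. -/
def ExtOneCommutesWithDirectLimits [HasExt.{w} C] (S S' : ObjectProperty C) : Prop :=
  ∀ P : S.FullSubcategory, IsFinitelyPresentable.{w} P →
    ∀ (J : Type w) [PartialOrder J] [IsDirectedOrder J] [Nonempty J] (D : J ⥤ C),
      (∀ j, S' (D.obj j)) → PreservesColimit D (Abelian.extFunctorObj.{w} P.obj 1)

/-- `E` and `T` are quasi locally coherent, `Ext¹_C(P, -)` commutes with direct limits of `T` for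
`P` in `fp(E)`, and `Ext¹_C(Q, -)` commutes with direct limits of `E` for `Q` in `fp(T)`. -/
def ConditionB [HasExt.{w} C] (E T : ObjectProperty C) : Prop :=
  (IsQuasiLocallyCoherent.{w} E.FullSubcategory ∧ IsQuasiLocallyCoherent.{w} T.FullSubcategory) ∧
    ExtOneCommutesWithDirectLimits.{w} E T ∧ ExtOneCommutesWithDirectLimits.{w} T E

/-- `E` and `T` are quasi locally coherent, `Ext¹_C(P, -)` commutes with direct limits of `T` for
`P` in `fp(E)`, and the torsion pair `(E, T)` restricts to `fp(C)`. -/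
def ConditionC [HasExt.{w} C] (E T : ObjectProperty C) : Prop :=
  (IsQuasiLocallyCoherent.{w} E.FullSubcategory ∧ IsQuasiLocallyCoherent.{w} T.FullSubcategory) ∧
    ExtOneCommutesWithDirectLimits.{w} E T ∧ RestrictsToFP.{w} E T

end Torsion

end LCTTF

/-! Write `x(B)` and `y(B)` for the parts of `B` in `E` and `T`. Both `T` (a torsion class) and `F`
are closed under direct limits, so `(E, T)` and `(T, F)` both have torsion radicals commuting with
filtered colimits. Hence an object of `E` or `T` is finitely presented there exactly when it is so
in `C`. The class `T` is closed under subobjects and quotients, and `y`, a left adjoint to a functor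
preserving filtered colimits, preserves finite presentation.

(a) implies (b): finitely presented objects are closed under kernels, so `x(B)` is finitely
presented with `B`. Applying `x` and `y` to direct systems in `C` makes `E` and `T` locally finitely
presented. Every class in `Ext¹(B, -)` dies on a finitely presented cover of `B` with finitely
presented kernel, which reduces Ext to Hom.

(b) implies (c): by (iii) the class of `0 ⟶ x(B) ⟶ B ⟶ y(B) ⟶ 0` comes from a finitely presented
term of a system with colimit `x(B)`; this exhibits `x(B)` as a retract of such a term
(`restrictsToFP`). The same descent of classes shows that finitely presented objects separate, so
(b) makes `C` locally finitely presented (`isSeparating`).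

(c) implies (a): it remains to show closure under kernels. Splitting the source by `(E, T)` leaves
morphisms from `E` to `E` and from `T` to an arbitrary object. The crux is
`isFinitelyPresentable_right_of_shortExact`: if `K` is the kernel of an epimorphism in `fp(E)`, then
on `T` the functor `Hom(y(K), -)` is the kernel of a map between `Ext¹` functors, to which (ii)
applies.

A recurrent tool is `ext_exists_eq_zero`: for finitely presented `B`, a class in `Ext¹(B, -)` that
dies in a filtered colimit dies at a finite stage. -/

namespace LCTTF

open Opposite Abelian

attribute [local instance] Cardinal.fact_isRegular_aleph0

/-! ### Finitely presented objects, tested on direct systems -/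

section FinitelyPresented

variable {A : Type u} [Category.{v} A]

theorem isFinitelyPresentable_of_iso {X Y : A} (e : X ≅ Y) (hX : IsFinitelyPresentable.{v} X) :
    IsFinitelyPresentable.{v} Y :=
  isCardinalPresentable_of_iso e _

/-- Finite presentability can be tested on direct systems. -/
theorem isFinitelyPresentable_of_directed [Preadditive A] (X : A)
    (h : ∀ (J : Type v) [PartialOrder J] [IsDirectedOrder J] [Nonempty J] (D : J ⥤ A)
      (c : Cocone D), IsColimit c →
      (∀ f : X ⟶ c.pt, ∃ (j : J) (g : X ⟶ D.obj j), g ≫ c.ι.app j = f) ∧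
      (∀ (j : J) (g : X ⟶ D.obj j), g ≫ c.ι.app j = 0 →
        ∃ (k : J) (u : j ⟶ k), g ≫ D.map u = 0)) :
    IsFinitelyPresentable.{v} X := by
  rw [isFinitelyPresentable_iff_preservesFilteredColimitsOfSize]
  refine ⟨fun J _ _ ↦ ⟨fun {D} ↦ ⟨fun {c} hc ↦ ?_⟩⟩⟩
  obtain ⟨J', _, _, _, G, _⟩ := IsFiltered.exists_directed J
  obtain ⟨h₁, h₂⟩ := h J' (G ⋙ D) (c.whisker G) ((Functor.Final.isColimitWhiskerEquiv G c).symm hc)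
  refine ⟨Functor.Final.isColimitWhiskerEquiv G _ ?_⟩
  refine Types.FilteredColimit.isColimitOf' _ _ (fun f ↦ ?_) (fun j f g hfg ↦ ?_)
  · obtain ⟨j, g, hg⟩ := h₁ f
    exact ⟨j, g, hg.symm⟩
  · dsimp at f g hfg ⊢
    obtain ⟨k, u, hu⟩ := h₂ j (f - g) (by
      dsimp
      rw [Preadditive.sub_comp, hfg, sub_self])
    exact ⟨k, u, by rwa [Preadditive.sub_comp, sub_eq_zero] at hu⟩

theorem isFinitelyPresentable_exists_zero [Preadditive A] {X : A} (hX : IsFinitelyPresentable.{v} X)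
    {J : Type v} [SmallCategory J] [IsFiltered J] {D : J ⥤ A} {c : Cocone D} (hc : IsColimit c)
    {j : J} (g : X ⟶ D.obj j) (hg : g ≫ c.ι.app j = 0) :
    ∃ (k : J) (u : j ⟶ k), g ≫ D.map u = 0 := by
  obtain ⟨k, u, v, h⟩ := IsFinitelyPresentable.exists_eq_of_isColimit hc g (0 : X ⟶ D.obj j)
    (by rw [hg, zero_comp])
  exact ⟨k, u, by rw [h, zero_comp]⟩

instance isClosedUnderColimitsOfShape_isFinitelyPresentable {K : Type} [SmallCategory K]
    [FinCategory K] :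
    (ObjectProperty.isFinitelyPresentable.{v} A).IsClosedUnderColimitsOfShape K :=
  isClosedUnderColimitsOfShape_isCardinalPresentable.{v} A (by
    rw [hasCardinalLT_aleph0_iff]
    infer_instance)

theorem isFinitelyPresentable_of_retract {X Y : A} (i : X ⟶ Y) (r : Y ⟶ X) (h : i ≫ r = 𝟙 X)
    (hY : IsFinitelyPresentable.{v} Y) : IsFinitelyPresentable.{v} X :=
  Retract.isCardinalPresentable { i := i, r := r, retract := h } _

end FinitelyPresented

/-! ### Filtered colimits of pushouts -/

section Pushout

variable {C : Type u} [Category.{v} C] {J : Type v} [SmallCategory J] {D : J ⥤ C} {j : J} {I : C} {i : D.obj j ⟶ I}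
  {M : Under j → C} {inl : ∀ k, I ⟶ M k} {inr : ∀ k : Under j, D.obj k.right ⟶ M k}

/-- The functor formed by pushouts of `i : D.obj j ⟶ I` along the morphisms
`D.obj j ⟶ D.obj k`. -/
noncomputable abbrev pushoutFunctor (sq : ∀ k, IsPushout i (D.map k.hom) (inl k) (inr k)) :
    Under j ⥤ C where
  obj := M
  map {k l} u := (sq k).desc (inl l) (D.map u.right ≫ inr l) (by
    rw [← Functor.map_comp_assoc, Under.w u, (sq l).w])
  map_id k := (sq k).hom_ext (by simp) (by simp)
  map_comp u v := (sq _).hom_ext (by simp) (by simp)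

/-- Pushouts commute with filtered colimits. -/
theorem exists_isColimit_pushoutFunctor [IsFiltered J] {c : Cocone D} (hc : IsColimit c)
    (sq : ∀ k, IsPushout i (D.map k.hom) (inl k) (inr k)) {M' : C} {inl' : I ⟶ M'}
    {inr' : c.pt ⟶ M'} (sq' : IsPushout i (c.ι.app j) inl' inr') :
    ∃ (a : pushoutFunctor sq ⟶ (Functor.const _).obj M') (_ : IsColimit (Cocone.mk M' a)),
      (∀ k, inl k ≫ a.app k = inl') ∧ (∀ k, inr k ≫ a.app k = c.ι.app k.right ≫ inr') := by
  let a : pushoutFunctor sq ⟶ (Functor.const _).obj M' :=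
    { app k := (sq k).desc inl' (c.ι.app k.right ≫ inr') (by rw [c.w_assoc, sq'.w])
      naturality k l u := (sq k).hom_ext (by simp) (by simp) }
  have ha₁ (k) : inl k ≫ a.app k = inl' := (sq k).inl_desc _ _ _
  have ha₂ (k) : inr k ≫ a.app k = c.ι.app k.right ≫ inr' := (sq k).inr_desc _ _ _
  let hc' : IsColimit (c.whisker (Under.forget j)) :=
    (Functor.Final.isColimitWhiskerEquiv (Under.forget j) c).symm hc
  let s₂ (s : Cocone (pushoutFunctor sq)) : Cocone (Under.forget j ⋙ D) :=
    { pt := s.pt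
      ι :=
        { app k := inr k ≫ s.ι.app k
          naturality k l u := by
            have := s.w u
            dsimp at this ⊢
            rw [← this, IsPushout.inr_desc_assoc]
            simp } }
  have fac (s) (k : Under j) : c.ι.app k.right ≫ hc'.desc (s₂ s) = inr k ≫ s.ι.app k :=
    hc'.fac (s₂ s) k
  have hl (s : Cocone (pushoutFunctor sq)) (k : Under j) :
      inl k ≫ s.ι.app k = inl (Under.mk (𝟙 j)) ≫ s.ι.app (Under.mk (𝟙 j)) := by
    have := s.w (Under.homMk k.hom : Under.mk (𝟙 j) ⟶ k)
    dsimp at this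
    rw [← this, IsPushout.inl_desc_assoc]
  refine ⟨a,
    { desc s := sq'.desc (inl (Under.mk (𝟙 j)) ≫ s.ι.app (Under.mk (𝟙 j)))
        (hc'.desc (s₂ s)) ?_
      fac s k := (sq k).hom_ext ?_ ?_
      uniq s m hm := sq'.hom_ext ?_ (hc'.hom_ext fun k ↦ ?_) }, ha₁, ha₂⟩
  · have h₁ := fac s (Under.mk (𝟙 j))
    have h₂ := (sq (Under.mk (𝟙 j))).w
    dsimp at h₁ h₂
    rw [h₁, reassoc_of% h₂]
    simp
  · dsimp
    rw [reassoc_of% (ha₁ k), IsPushout.inl_desc, hl s k]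
  · dsimp
    rw [reassoc_of% (ha₂ k), IsPushout.inr_desc, fac]
  · dsimp at m hm ⊢
    rw [IsPushout.inl_desc, ← hm, reassoc_of% (ha₁ (Under.mk (𝟙 j)))]
  · dsimp at m hm ⊢
    rw [IsPushout.inr_desc, fac, ← hm, reassoc_of% (ha₂ k)]

end Pushout

/-! ### Ext¹ and filtered colimits -/

section Ext

variable {C : Type u} [Category.{v} C] [Abelian C]

theorem shortExact_of_isPushout {X₁ X₂ X₃ Y₁ Y₂ : C} {f : X₁ ⟶ X₂} {g : X₂ ⟶ X₃}
    {h : f ≫ g = 0} (hS : (ShortComplex.mk f g h).ShortExact) {a : X₁ ⟶ Y₁} {b : X₂ ⟶ Y₂}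
    {f' : Y₁ ⟶ Y₂} (sq : IsPushout f a b f') {g' : Y₂ ⟶ X₃} (hb : b ≫ g' = g)
    (h' : f' ≫ g' = 0) : (ShortComplex.mk f' g' h').ShortExact := by
  have := hS.mono_f
  have := hS.epi_g
  dsimp at *
  have : Mono f' := (MorphismProperty.monomorphisms C).of_isPushout sq.flip ‹Mono f›
  have : Epi g' := by
    have : Epi (b ≫ g') := by rwa [hb]
    exact epi_of_epi b g'
  refine ShortComplex.ShortExact.mk' (ShortComplex.exact_of_g_is_cokernel _ ?_) ‹_› ‹_›
  refine CokernelCofork.IsColimit.ofπ' _ _ (fun {Z} k hk ↦ ?_)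
  dsimp at k hk ⊢
  have hbk : f ≫ b ≫ k = 0 := by rw [sq.w_assoc, hk, comp_zero]
  refine ⟨hS.exact.desc (b ≫ k) hbk, ?_⟩
  apply sq.hom_ext
  · rw [reassoc_of% hb]
    exact hS.exact.g_desc _ _
  · rw [reassoc_of% h', zero_comp, hk]

theorem shortExact_of_isPullback {X₁ X₂ X₃ Y₂ Y₃ : C} {f : X₁ ⟶ X₂} {g : X₂ ⟶ X₃}
    {h : f ≫ g = 0} (hS : (ShortComplex.mk f g h).ShortExact) {b : Y₂ ⟶ X₂} {c : Y₃ ⟶ X₃}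
    {g' : Y₂ ⟶ Y₃} (sq : IsPullback b g' g c) {f' : X₁ ⟶ Y₂} (hb : f' ≫ b = f)
    (h' : f' ≫ g' = 0) : (ShortComplex.mk f' g' h').ShortExact := by
  have := hS.mono_f
  have := hS.epi_g
  dsimp at *
  have : Epi g' := (MorphismProperty.epimorphisms C).of_isPullback sq ‹Epi g›
  have : Mono f' := by
    have : Mono (f' ≫ b) := by rwa [hb]
    exact mono_of_mono f' b
  refine ShortComplex.ShortExact.mk' (ShortComplex.exact_of_f_is_kernel _ ?_) ‹_› ‹_›
  refine KernelFork.IsLimit.ofι' _ _ (fun {Z} k hk ↦ ?_)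
  dsimp at k hk ⊢
  have hbk : (k ≫ b) ≫ g = 0 := by rw [Category.assoc, sq.w, reassoc_of% hk, zero_comp]
  refine ⟨hS.exact.lift (k ≫ b) hbk, ?_⟩
  apply sq.hom_ext
  · rw [Category.assoc, hb]
    exact hS.exact.lift_f _ _
  · rw [Category.assoc, h', comp_zero, hk]

variable [HasExt.{v} C]

theorem preservesColimit_extFunctorObj_iff {J : Type v} [SmallCategory J] [IsFiltered J]
    {D : J ⥤ C} {c : Cocone D} (hc : IsColimit c) (P : C) :
    PreservesColimit D (extFunctorObj.{v} P 1) ↔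
      (∀ x : Ext.{v} P c.pt 1, ∃ (j : J) (y : Ext.{v} P (D.obj j) 1),
        y.comp (Ext.mk₀ (c.ι.app j)) (add_zero 1) = x) ∧
      (∀ (j : J) (y : Ext.{v} P (D.obj j) 1), y.comp (Ext.mk₀ (c.ι.app j)) (add_zero 1) = 0 →
        ∃ (k : J) (u : j ⟶ k), y.comp (Ext.mk₀ (D.map u)) (add_zero 1) = 0) := by
  constructor
  · intro _
    have hc' := isColimitOfPreserves (extFunctorObj.{v} P 1) hc
    refine ⟨fun x ↦ ?_, fun j y hy ↦ ?_⟩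
    · obtain ⟨j, y, hy⟩ := Concrete.isColimit_exists_rep _ hc' x
      exact ⟨j, y, hy⟩
    · obtain ⟨k, u, u', h⟩ := Concrete.isColimit_exists_of_rep_eq.{v} _ hc' y
        (0 : Ext.{v} P (D.obj j) 1) (hy.trans (map_zero _).symm)
      exact ⟨k, u, h.trans (map_zero _)⟩
  · rintro ⟨h₁, h₂⟩
    have : ReflectsColimitsOfShape J (forget AddCommGrpCat.{v}) :=
      reflectsColimitsOfShape_of_reflectsIsomorphisms
    refine preservesColimit_of_preserves_colimit_cocone hc
      (isColimitOfReflects (forget AddCommGrpCat.{v}) ?_)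
    refine Types.FilteredColimit.isColimitOf' _ _ (fun x ↦ ?_) (fun j x y hxy ↦ ?_)
    · obtain ⟨j, y, hy⟩ := h₁ x
      exact ⟨j, y, hy.symm⟩
    · change Ext.{v} P (D.obj j) 1 at x y
      replace hxy : x.comp (Ext.mk₀ (c.ι.app j)) (add_zero 1) =
        y.comp (Ext.mk₀ (c.ι.app j)) (add_zero 1) := hxy
      obtain ⟨k, u, hu⟩ := h₂ j (x - y) (by rw [sub_eq_add_neg, Ext.add_comp, Ext.neg_comp, hxy, add_neg_cancel])
      rw [sub_eq_add_neg, Ext.add_comp, Ext.neg_comp, add_neg_eq_zero] at hu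
      exact ⟨k, u, hu⟩

variable [EnoughInjectives C]

/-- Dimension shift: `Ext¹(B, I)` vanishes for `I` injective, so the connecting map from `Hom(B, N)`
is onto. -/
theorem exists_injective_extClass {B X : C} (x : Ext.{v} B X 1) :
    ∃ (I N : C) (i : X ⟶ I) (p : I ⟶ N) (h : i ≫ p = 0)
      (hS : (ShortComplex.mk i p h).ShortExact) (φ : B ⟶ N),
      (Ext.mk₀ φ).comp hS.extClass (zero_add 1) = x := by
  let i := Injective.ι X
  have hS : (ShortComplex.mk i (cokernel.π i) (cokernel.condition i)).ShortExact :=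
    .mk' (ShortComplex.exact_of_g_is_cokernel _ (cokernelIsCokernel i)) inferInstance inferInstance
  obtain ⟨y, hy⟩ := Ext.covariant_sequence_exact₁ B hS x (Ext.eq_zero_of_injective _) (zero_add 1)
  obtain ⟨φ, rfl⟩ := Ext.addEquiv₀.symm.surjective y
  exact ⟨_, _, _, _, _, hS, φ, hy⟩

/-- Every class in `Ext¹(B, X)` is the class of a short exact sequence; in particular it dies on an
extension of `B` by `X`. -/
theorem exists_shortExact_comp_eq_zero {B X : C} (x : Ext.{v} B X 1) :
    ∃ (M : C) (i : X ⟶ M) (p : M ⟶ B) (h : i ≫ p = 0), (ShortComplex.mk i p h).ShortExact ∧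
      (Ext.mk₀ p).comp x (zero_add 1) = 0 := by
  obtain ⟨I, N, i, p, h, hS, φ, rfl⟩ := exists_injective_extClass x
  -- The extension is the pullback of `0 ⟶ X ⟶ I ⟶ N ⟶ 0` along `φ`. On it `φ` lifts to `I`, which
  -- kills the class.
  have sq := IsPullback.of_hasPullback p φ
  have hl : i ≫ p = (0 : X ⟶ B) ≫ φ := by rw [h, zero_comp]
  refine ⟨pullback p φ, sq.lift i 0 hl, pullback.snd p φ, sq.lift_snd _ _ _,
    shortExact_of_isPullback hS sq (sq.lift_fst _ _ _) (sq.lift_snd _ _ _), ?_⟩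
  rw [Ext.mk₀_comp_mk₀_assoc, ← pullback.condition, ← Ext.mk₀_comp_mk₀_assoc]
  have := hS.comp_extClass
  dsimp at this
  rw [this, Ext.comp_zero]

/-- If `B` is finitely presented, then `Ext¹(B, -)` satisfies the injectivity half of the
commutation with filtered colimits. -/
theorem ext_exists_eq_zero {B : C} (hB : IsFinitelyPresentable.{v} B)
    {J : Type v} [SmallCategory J] [IsFiltered J] {D : J ⥤ C} {c : Cocone D} (hc : IsColimit c)
    {j : J} (x : Ext.{v} B (D.obj j) 1) (hx : x.comp (Ext.mk₀ (c.ι.app j)) (add_zero 1) = 0) :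
    ∃ (k : J) (u : j ⟶ k), x.comp (Ext.mk₀ (D.map u)) (add_zero 1) = 0 := by
  obtain ⟨I, N, i, p, h, hS, φ, rfl⟩ := exists_injective_extClass x
  -- The image of the class under `a` is the pullback along `φ` of the pushed-out sequence, so it
  -- vanishes exactly when `φ` lifts to the pushout.
  have key {Y M : C} {a : D.obj j ⟶ Y} {inl : I ⟶ M} {inr : Y ⟶ M} (sq : IsPushout i a inl inr) :
      ∃ (q : M ⟶ N) (_ : inl ≫ q = p) (h' : inr ≫ q = 0)
        (hS' : (ShortComplex.mk inr q h').ShortExact),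
      ((Ext.mk₀ φ).comp hS.extClass (zero_add 1)).comp (Ext.mk₀ a) (add_zero 1) =
        (Ext.mk₀ φ).comp hS'.extClass (zero_add 1) := by
    have hq : i ≫ p = a ≫ 0 := by rw [h, comp_zero]
    have hS' := shortExact_of_isPushout hS sq (g' := sq.desc p 0 hq) (by simp) (by simp)
    refine ⟨sq.desc p 0 hq, by simp, by simp, hS', ?_⟩
    have nat := ShortComplex.ShortExact.extClass_naturality hS hS'
      { τ₁ := a, τ₂ := inl, τ₃ := 𝟙 N, comm₁₂ := sq.w.symm, comm₂₃ := by simp }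
    dsimp at nat
    rw [Ext.mk₀_id_comp] at nat
    rw [Ext.comp_assoc_of_third_deg_zero, nat]
  have sq (k : Under j) := IsPushout.of_hasPushout i (D.map k.hom)
  have sq' := IsPushout.of_hasPushout i (c.ι.app j)
  obtain ⟨a, ha, ha₁, ha₂⟩ := exists_isColimit_pushoutFunctor hc sq sq'
  obtain ⟨q, hq₁, hq₂, hS', e⟩ := key sq'
  replace e := e.symm.trans hx
  obtain ⟨y, hy⟩ := Ext.covariant_sequence_exact₃ B hS' _ _ e
  obtain ⟨ψ, rfl⟩ := Ext.addEquiv₀.symm.surjective y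
  dsimp at hy
  simp only [Ext.addEquiv₀_symm_apply, Ext.mk₀_comp_mk₀] at hy
  replace hy := Ext.addEquiv₀.symm.injective hy
  -- The lift `ψ` of `φ` goes to a filtered colimit of pushouts, so it already exists at a finite
  -- stage.
  obtain ⟨k, χ, hχ⟩ := IsFinitelyPresentable.exists_hom_of_isColimit ha ψ
  refine ⟨k.right, k.hom, ?_⟩
  obtain ⟨r, hr₁, hr₂, hS'', e'⟩ := key (sq k)
  have hr : a.app k ≫ q = r := by
    refine (sq k).hom_ext ?_ ?_
    · rw [reassoc_of% (ha₁ k), hq₁, hr₁]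
    · rw [reassoc_of% (ha₂ k), hq₂, hr₂, comp_zero]
  have : φ = χ ≫ r := by
    rw [← hr, ← hy, ← hχ]
    exact Category.assoc _ _ _
  subst this
  have comp := hS''.comp_extClass
  dsimp at comp
  refine e'.trans ?_
  rw [← Ext.mk₀_comp_mk₀_assoc, comp, Ext.comp_zero]

end Ext

/-! ### Long exact sequences in low degree, and extensions -/

section ExtSequences

variable {C : Type u} [Category.{v} C] [Abelian C] [HasExt.{v} C] {S : ShortComplex C}
  (hS : S.ShortExact)

include hS

theorem exists_extension {Y : C} (f : S.X₁ ⟶ Y)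
    (hf : hS.extClass.comp (Ext.mk₀ f) (add_zero 1) = 0) : ∃ g : S.X₂ ⟶ Y, S.f ≫ g = f := by
  obtain ⟨x, hx⟩ := Ext.contravariant_sequence_exact₁ hS Y (Ext.mk₀ f) (add_zero 1) hf
  obtain ⟨g, rfl⟩ := Ext.addEquiv₀.symm.surjective x
  simp only [Ext.addEquiv₀_symm_apply, Ext.mk₀_comp_mk₀] at hx
  exact ⟨g, Ext.addEquiv₀.symm.injective hx⟩

theorem extClass_comp_mk₀_f_comp {Y : C} (g : S.X₂ ⟶ Y) :
    hS.extClass.comp (Ext.mk₀ (S.f ≫ g)) (add_zero 1) = 0 := by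
  rw [← Ext.mk₀_comp_mk₀, ← Ext.comp_assoc_of_third_deg_zero, hS.extClass_comp, Ext.zero_comp]

theorem exists_lift {X : C} (f : X ⟶ S.X₃)
    (hf : (Ext.mk₀ f).comp hS.extClass (zero_add 1) = 0) : ∃ g : X ⟶ S.X₂, g ≫ S.g = f := by
  obtain ⟨x, hx⟩ := Ext.covariant_sequence_exact₃ X hS (Ext.mk₀ f) (zero_add 1) hf
  obtain ⟨g, rfl⟩ := Ext.addEquiv₀.symm.surjective x
  simp only [Ext.addEquiv₀_symm_apply, Ext.mk₀_comp_mk₀] at hx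
  exact ⟨g, Ext.addEquiv₀.symm.injective hx⟩

theorem exists_eq_extClass_comp {Y : C} (x : Ext.{v} S.X₃ Y 1)
    (hx : (Ext.mk₀ S.g).comp x (zero_add 1) = 0) :
    ∃ f : S.X₁ ⟶ Y, hS.extClass.comp (Ext.mk₀ f) (add_zero 1) = x := by
  obtain ⟨y, hy⟩ := Ext.contravariant_sequence_exact₃ hS Y x hx (add_zero 1)
  obtain ⟨f, rfl⟩ := Ext.addEquiv₀.symm.surjective y
  exact ⟨f, hy⟩

/-- Finitely presented objects are closed under extensions. -/
theorem isFinitelyPresentable_of_shortExact [EnoughInjectives C]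
    (h₁ : IsFinitelyPresentable.{v} S.X₁) (h₃ : IsFinitelyPresentable.{v} S.X₃) :
    IsFinitelyPresentable.{v} S.X₂ := by
  have := hS.epi_g
  refine isFinitelyPresentable_of_directed _ (fun J _ _ _ D c hc ↦ ⟨fun f ↦ ?_, fun j g hg ↦ ?_⟩)
  · obtain ⟨j, a, ha⟩ := IsFinitelyPresentable.exists_hom_of_isColimit hc (S.f ≫ f)
    -- The obstruction to extending `a` to `S.X₂` vanishes in the colimit, hence at a finite stage.
    -- The extension `b` then differs from `f` by a morphism through `S.X₃`, which descends as well.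
    obtain ⟨k, u, hu⟩ := ext_exists_eq_zero h₃ hc (hS.extClass.comp (Ext.mk₀ a) (add_zero 1)) (by
      rw [Ext.comp_assoc_of_third_deg_zero, Ext.mk₀_comp_mk₀, ha, extClass_comp_mk₀_f_comp])
    rw [Ext.comp_assoc_of_third_deg_zero, Ext.mk₀_comp_mk₀] at hu
    obtain ⟨b, hb⟩ := exists_extension hS _ hu
    have hz : S.f ≫ (f - (b ≫ c.ι.app k : S.X₂ ⟶ c.pt)) = 0 := by
      rw [Preadditive.comp_sub, reassoc_of% hb, c.w, ha, sub_self]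
    obtain ⟨l, d, hd⟩ := IsFinitelyPresentable.exists_hom_of_isColimit hc (hS.exact.desc _ hz)
    have hd' := hS.exact.g_desc _ hz
    rw [← hd] at hd'
    refine ⟨IsFiltered.max k l, b ≫ D.map (IsFiltered.leftToMax k l) +
      S.g ≫ d ≫ D.map (IsFiltered.rightToMax k l), ?_⟩
    rw [Preadditive.add_comp, Category.assoc, Category.assoc, Category.assoc, c.w, c.w, hd']
    abel
  · obtain ⟨k, u, hu⟩ := isFinitelyPresentable_exists_zero h₁ hc (S.f ≫ g) (by
      rw [Category.assoc, hg, comp_zero])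
    rw [Category.assoc] at hu
    have hd := hS.exact.g_desc _ hu
    obtain ⟨l, u', hu'⟩ := isFinitelyPresentable_exists_zero h₃ hc (hS.exact.desc _ hu) (by
      rw [← cancel_epi S.g, reassoc_of% hd, c.w, hg, comp_zero])
    refine ⟨l, u ≫ u', ?_⟩
    rw [D.map_comp, ← Category.assoc, ← hd, Category.assoc, hu', comp_zero]

end ExtSequences

/-! ### Local finite presentability and local coherence -/

section Grothendieck

variable {C : Type u} [Category.{v} C] [Abelian C]

theorem isFinitelyPresentable_cokernel {X Y : C} (f : X ⟶ Y) (hX : IsFinitelyPresentable.{v} X)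
    (hY : IsFinitelyPresentable.{v} Y) : IsFinitelyPresentable.{v} (cokernel f) :=
  (ObjectProperty.isFinitelyPresentable.{v} C).prop_colimit (parallelPair f 0) (by
    rintro (_ | _)
    · exact hX
    · exact hY)

theorem isFinitelyPresentable_of_isZero {X : C} (hX : IsZero X) : IsFinitelyPresentable.{v} X :=
  isFinitelyPresentable_of_directed _ fun _ _ _ _ _ _ _ ↦
    ⟨fun _ ↦ ⟨Classical.arbitrary _, 0, hX.eq_of_src _ _⟩, fun j _ _ ↦ ⟨j, 𝟙 _, hX.eq_of_src _ _⟩⟩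

theorem isClosedUnderKernels_of_kernel
    (h : ∀ ⦃X Y : C⦄ (f : X ⟶ Y), IsFinitelyPresentable.{v} X → IsFinitelyPresentable.{v} Y →
      IsFinitelyPresentable.{v} (kernel f)) :
    (ObjectProperty.isFinitelyPresentable.{v} C).IsClosedUnderKernels where
  kernels_le := by
    rintro _ ⟨f, k, hk, hX, hY⟩
    exact isFinitelyPresentable_of_iso ((kernelIsKernel f).conePointUniqueUpToIso hk) (h f hX hY)

theorem isFinitelyPresentable_kernel
    [(ObjectProperty.isFinitelyPresentable.{v} C).IsClosedUnderKernels] {X Y : C} (f : X ⟶ Y)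
    (hX : IsFinitelyPresentable.{v} X) (hY : IsFinitelyPresentable.{v} Y) :
    IsFinitelyPresentable.{v} (kernel f) :=
  (ObjectProperty.isFinitelyPresentable.{v} C).prop_kernel f hX hY

theorem nonempty_abelian_of_isClosedUnderKernels
    [(ObjectProperty.isFinitelyPresentable.{v} C).IsClosedUnderKernels] :
    Nonempty (Abelian (ObjectProperty.isFinitelyPresentable.{v} C).FullSubcategory) := by
  let P := ObjectProperty.isFinitelyPresentable.{v} C
  have : P.ContainsZero := ⟨_, isZero_zero C, isFinitelyPresentable_of_isZero (isZero_zero C)⟩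
  have : P.IsClosedUnderCokernels := ⟨by
    rintro _ ⟨f, k, hk, hX, hY⟩
    exact isFinitelyPresentable_of_iso ((cokernelIsCokernel f).coconePointUniqueUpToIso hk)
      (isFinitelyPresentable_cokernel f hX hY)⟩
  have : P.IsClosedUnderFiniteProducts := ⟨fun J _ ↦ .mk' (by
    rintro _ ⟨F, hF⟩
    have : HasFiniteBiproducts C := .of_hasFiniteProducts
    have := Fintype.ofFinite J
    have : P.IsClosedUnderColimitsOfShape (Discrete J) := by
      classical
      exact isClosedUnderColimitsOfShape_isFinitelyPresentable
    refine P.prop_of_iso (X := colimit F) ?_ (P.prop_colimit F hF)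
    exact (HasColimit.isoOfNatIso (Discrete.natIsoFunctor)) ≪≫ (biproduct.isoCoproduct _).symm ≪≫
      biproduct.isoProduct _ ≪≫ (HasLimit.isoOfNatIso (Discrete.natIsoFunctor)).symm)⟩
  exact ⟨inferInstanceAs (Abelian P.FullSubcategory)⟩

theorem isSeparating_of_isLocallyFinitelyPresented (h : IsLocallyFinitelyPresented.{v} C) :
    (ObjectProperty.isFinitelyPresentable.{v} C).IsSeparating :=
  ObjectProperty.IsSeparating.mk_of_exists_colimitsOfShape.{v} (fun X ↦ by
    obtain ⟨J, _, _, _, hJ⟩ := h.exists_directLimit X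
    exact ⟨J, _, hJ⟩)

/-- A kernel formed inside `fp(C)` has the right universal property only against finitely presented
objects. These separate, hence detect isomorphisms, so it agrees with the kernel in `C`. -/
theorem isClosedUnderKernels_of_isLocallyCoherent (h : IsLocallyCoherent.{v} C) :
    (ObjectProperty.isFinitelyPresentable.{v} C).IsClosedUnderKernels := by
  let P := ObjectProperty.isFinitelyPresentable.{v} C
  have : HasEqualizers P.FullSubcategory := by
    obtain ⟨_⟩ := h.abelian_fp
    infer_instance
  refine isClosedUnderKernels_of_kernel (fun X Y f hX hY ↦ ?_)
  let f' : (⟨X, hX⟩ : P.FullSubcategory) ⟶ ⟨Y, hY⟩ := P.homMk f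
  let k := equalizer.ι f' 0
  have hk : k.hom ≫ f = 0 := by
    have : k.hom ≫ f = k.hom ≫ 0 := congr($(equalizer.condition f' 0).hom)
    rw [this, comp_zero]
  have : IsIso (kernel.lift f k.hom hk) := by
    refine (isSeparating_of_isLocallyFinitelyPresented
      h.isLocallyFinitelyPresented).isDetecting _ (fun G hG a ↦ ?_)
    let b : (⟨G, hG⟩ : P.FullSubcategory) ⟶ ⟨X, hX⟩ := P.homMk (a ≫ kernel.ι f)
    have hb : b ≫ f' = b ≫ 0 := by
      ext
      simp [b, f']
    refine ⟨(equalizer.lift b hb).hom, ?_, fun c hc ↦ ?_⟩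
    · have : (equalizer.lift b hb).hom ≫ k.hom = a ≫ kernel.ι f :=
        congr($(equalizer.lift_ι b hb).hom)
      dsimp only
      rw [← cancel_mono (kernel.ι f), Category.assoc, kernel.lift_ι, this]
    · have : P.homMk c = equalizer.lift b hb := by
        refine equalizer.hom_ext ?_
        ext
        rw [equalizer.lift_ι]
        simp [b, ← hc, k]
      exact congr($(this).hom)
  exact isFinitelyPresentable_of_iso (asIso (kernel.lift f k.hom hk)) (equalizer f' 0).property

variable [IsGrothendieckAbelian.{v} C]

/-- A separator `G` has only a small set of subobjects. For each proper one, a single morphism from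
an object of `P` to `G` that avoids it suffices: a nonzero `a ≫ h` out of `G` has a proper kernel,
and the morphism chosen for that kernel is not killed. -/
theorem exists_small_isSeparating {P : ObjectProperty C} (hP : P.IsSeparating) :
    ∃ (Q : ObjectProperty C) (_ : ObjectProperty.Small.{v} Q), Q.IsSeparating ∧ Q ≤ P := by
  let G := separator C
  have hG : IsSeparator G := isSeparator_separator C
  have key (U : {U : Subobject G // U ≠ ⊤}) :
      ∃ (X : C) (_ : P X) (f : X ⟶ G), ¬ U.1.Factors f := by
    by_contra! H
    refine U.2 ?_
    have : Epi U.1.arrow := by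
      refine Preadditive.epi_of_cokernel_zero ?_
      refine (Preadditive.isSeparating_iff _).1 hP _ (fun X hX f ↦ ?_)
      rw [← U.1.factorThru_arrow _ (H X hX f), Category.assoc, cokernel.condition, comp_zero]
    have : IsIso U.1.arrow := isIso_of_mono_of_epi _
    exact Subobject.eq_top_of_isIso_arrow _
  choose X hX f hf using key
  refine ⟨.ofObj X, inferInstance, (Preadditive.isSeparating_iff _).2 (fun A B h H ↦ ?_), ?_⟩
  · refine (Preadditive.isSeparator_iff G).1 hG _ (fun a ↦ ?_)
    by_contra ha
    have hU : kernelSubobject (a ≫ h) ≠ ⊤ := fun hU ↦ ha (by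
      have : IsIso (kernelSubobject (a ≫ h)).arrow := by
        rw [hU]
        infer_instance
      rw [← cancel_epi (kernelSubobject (a ≫ h)).arrow, kernelSubobject_arrow_comp, comp_zero])
    refine hf ⟨_, hU⟩ ((kernelSubobject_factors_iff _ _).2 ?_)
    rw [← Category.assoc]
    exact H _ (ObjectProperty.ofObj_apply _ _) _
  · rintro _ ⟨U⟩
    exact hX U

theorem isLocallyFinitelyPresented_of_isSeparating
    (h : (ObjectProperty.isFinitelyPresentable.{v} C).IsSeparating) :
    IsLocallyFinitelyPresented.{v} C := by
  obtain ⟨Q, _, hQ, hQ'⟩ := exists_small_isSeparating h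
  have : IsCardinalLocallyPresentable C Cardinal.aleph0.{v} := by
    rw [IsCardinalLocallyPresentable.iff_exists_isStrongGenerator]
    refine ⟨Q, inferInstance, ObjectProperty.isStrongGenerator_iff.2 ⟨hQ, fun X Y i _ hi ↦ ?_⟩, hQ'⟩
    refine hQ.isDetecting i (fun G hG a ↦ ?_)
    obtain ⟨b, hb⟩ := hi G hG a
    exact ⟨b, hb, fun b' hb' ↦ (cancel_mono i).1 (hb'.trans hb.symm)⟩
  obtain ⟨R, _, hR⟩ := HasCardinalFilteredGenerator.exists_generator C Cardinal.aleph0.{v}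
  refine ⟨.of_hasFiniteProducts, inferInstance, fun J _ _ _ ↦ inferInstance,
    hR.essentiallySmall_isPresentable, fun X ↦ ?_⟩
  obtain ⟨J, _, hJ, ⟨hX⟩⟩ := hR.exists_colimitsOfShape X
  rw [isCardinalFiltered_aleph0_iff] at hJ
  obtain ⟨J', _, _, _, F, _⟩ := IsFiltered.exists_directed J
  exact ⟨J', inferInstance, inferInstance, inferInstance,
    ⟨(hX.ofLE hR.le_isCardinalPresentable).reindex F⟩⟩

/-- A finitely presented quotient of a filtered colimit is a quotient of one of its terms. -/
theorem exists_epi_comp {J : Type v} [SmallCategory J] [IsFiltered J] {D : J ⥤ C} {c : Cocone D}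
    (hc : IsColimit c) {B : C} (hB : IsFinitelyPresentable.{v} B) (p : c.pt ⟶ B) [Epi p] :
    ∃ j, Epi (c.ι.app j ≫ p) := by
  let α : D ⟶ (Functor.const J).obj B := c.ι ≫ (Functor.const J).map p
  let q := cokernel.π α
  have hq (j k : J) (u : j ⟶ k) : q.app j ≫ (cokernel α).map u = q.app k := by
    rw [← q.naturality u]
    exact Category.id_comp _
  let j₀ : J := Classical.choice IsFiltered.nonempty
  -- The morphism from `B` to the colimit of the cokernels of `c.ι.app j ≫ p` vanishes because `p`
  -- is epi. Finite presentation of `B` makes it vanish at some stage, where the cokernel is then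
  -- zero.
  have h₀ : q.app j₀ ≫ colimit.ι (cokernel α) j₀ = 0 := by
    rw [← cancel_epi p, comp_zero]
    refine hc.hom_ext (fun j ↦ ?_)
    have h₁ : α.app j ≫ q.app j = 0 := congr_app (cokernel.condition α) j
    have h₂ : c.ι.app j ≫ p = α.app j := rfl
    have h₃ : q.app j₀ ≫ colimit.ι (cokernel α) j₀ = q.app j ≫ colimit.ι (cokernel α) j := by
      rw [← colimit.w _ (IsFiltered.leftToMax j₀ j), ← colimit.w _ (IsFiltered.rightToMax j₀ j),
        reassoc_of% (hq _ _ (IsFiltered.leftToMax j₀ j)),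
        reassoc_of% (hq _ _ (IsFiltered.rightToMax j₀ j))]
    rw [h₃, reassoc_of% h₂, reassoc_of% h₁, zero_comp, comp_zero]
  obtain ⟨k, u, hu⟩ := isFinitelyPresentable_exists_zero hB (colimit.isColimit (cokernel α))
    (q.app j₀) h₀
  rw [hq] at hu
  have ex := (ShortComplex.exact_of_g_is_cokernel (ShortComplex.mk α q (cokernel.condition α))
    (cokernelIsCokernel α)).map ((evaluation J C).obj k)
  exact ⟨k, ex.epi_f hu⟩

/-- In a locally coherent category `Ext¹(B, -)` commutes with filtered colimits for all finitely
presented `B`. -/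
theorem preservesColimit_extFunctorObj (h : IsLocallyCoherent.{v} C) {B : C}
    (hB : IsFinitelyPresentable.{v} B) {J : Type v} [SmallCategory J] [IsFiltered J] (D : J ⥤ C) :
    PreservesColimit D (extFunctorObj.{v} B 1) := by
  have := isClosedUnderKernels_of_isLocallyCoherent h
  -- The middle term of an extension representing `x` is a direct limit of finitely presented
  -- objects, one of which already covers `B`.
  have key {Y : C} (x : Ext.{v} B Y 1) : ∃ (B' : C) (_ : IsFinitelyPresentable.{v} B')
      (p : B' ⟶ B) (_ : Epi p), (Ext.mk₀ p).comp x (zero_add 1) = 0 := by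
    obtain ⟨M, i, p, w, hS, hp⟩ := exists_shortExact_comp_eq_zero x
    have : Epi p := hS.epi_g
    obtain ⟨J, _, _, _, ⟨c⟩⟩ := h.isLocallyFinitelyPresented.exists_directLimit M
    obtain ⟨j, hj⟩ := exists_epi_comp c.isColimit hB p
    exact ⟨_, c.prop_diag_obj j, _, hj, by rw [← Ext.mk₀_comp_mk₀_assoc, hp, Ext.comp_zero]⟩
  have sh {B' : C} (p : B' ⟶ B) [Epi p] :
      (ShortComplex.mk (kernel.ι p) p (kernel.condition p)).ShortExact :=
    .mk' (ShortComplex.exact_of_f_is_kernel _ (kernelIsKernel p)) inferInstance ‹_›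
  let c := colimit.cocone D
  have hc : IsColimit c := colimit.isColimit D
  refine (preservesColimit_extFunctorObj_iff hc B).2 ⟨fun x ↦ ?_, fun j x hx ↦ ?_⟩
  · obtain ⟨B', hB', p, _, hp⟩ := key x
    obtain ⟨f, rfl⟩ := exists_eq_extClass_comp (sh p) x hp
    have hK : IsFinitelyPresentable.{v} (kernel p) := isFinitelyPresentable_kernel p hB' hB
    obtain ⟨j, g, rfl⟩ := IsFinitelyPresentable.exists_hom_of_isColimit hc f
    exact ⟨j, (sh p).extClass.comp (Ext.mk₀ g) (add_zero 1), by
      rw [Ext.comp_assoc_of_third_deg_zero, Ext.mk₀_comp_mk₀]⟩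
  · exact ext_exists_eq_zero hB hc x hx

end Grothendieck

/-! ### Torsion pairs and torsion pairs of finite type -/

section Torsion

variable {C : Type u} [Category.{v} C] [Abelian C] {T F : ObjectProperty C}

namespace IsApproximation

variable {X M Y : C} {i : X ⟶ M} {p : M ⟶ Y} (h : IsApproximation T F i p)

include h

theorem comp_eq_zero : i ≫ p = 0 := h.2.2.choose

theorem shortExact : (ShortComplex.mk i p h.comp_eq_zero).ShortExact := h.2.2.choose_spec

theorem mono : Mono i := h.shortExact.mono_f

theorem epi : Epi p := h.shortExact.epi_g

theorem exists_lift (hTF : IsTorsionPair T F) {Z : C} (hZ : T Z) (f : Z ⟶ M) :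
    ∃ g, g ≫ i = f :=
  have := h.mono
  ⟨h.shortExact.exact.lift f (hTF.hom_eq_zero hZ h.2.1 _), h.shortExact.exact.lift_f _ _⟩

theorem exists_desc (hTF : IsTorsionPair T F) {Z : C} (hZ : F Z) (f : M ⟶ Z) :
    ∃ g, p ≫ g = f :=
  have := h.epi
  ⟨h.shortExact.exact.desc f (hTF.hom_eq_zero h.1 hZ _), h.shortExact.exact.g_desc _ _⟩

theorem exists_iso_left (hTF : IsTorsionPair T F) {X' Y' : C} {i' : X' ⟶ M} {p' : M ⟶ Y'}
    (h' : IsApproximation T F i' p') : ∃ e : X ≅ X', e.hom ≫ i' = i := by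
  have := h.mono
  have := h'.mono
  obtain ⟨a, ha⟩ := h'.exists_lift hTF h.1 i
  obtain ⟨b, hb⟩ := h.exists_lift hTF h'.1 i'
  exact ⟨⟨a, b, by simp [← cancel_mono i, ha, hb], by simp [← cancel_mono i', ha, hb]⟩, ha⟩

theorem exists_iso_right (hTF : IsTorsionPair T F) {X' Y' : C} {i' : X' ⟶ M} {p' : M ⟶ Y'}
    (h' : IsApproximation T F i' p') : ∃ e : Y ≅ Y', p ≫ e.hom = p' := by
  have := h.epi
  have := h'.epi
  obtain ⟨a, ha⟩ := h.exists_desc hTF h'.2.1 p'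
  obtain ⟨b, hb⟩ := h'.exists_desc hTF h.2.1 p
  exact ⟨⟨a, b, by rw [← cancel_epi p, reassoc_of% ha, hb, Category.comp_id],
    by rw [← cancel_epi p', reassoc_of% hb, ha, Category.comp_id]⟩, ha⟩

end IsApproximation

namespace IsTorsionPair

variable (hTF : IsTorsionPair T F)

include hTF

theorem left_iff (X : C) : T X ↔ ∀ ⦃Y : C⦄, F Y → ∀ f : X ⟶ Y, f = 0 := by
  refine ⟨fun hX Y hY f ↦ hTF.hom_eq_zero hX hY f, fun H ↦ ?_⟩
  obtain ⟨X', Y, i, p, h⟩ := hTF.exists_approximation X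
  have := h.mono
  have := h.shortExact.exact.epi_f (H h.2.1 p)
  have : IsIso i := isIso_of_mono_of_epi i
  have := hTF.isClosedUnderIsomorphisms_left
  exact T.prop_of_iso (asIso i) h.1

theorem right_iff (Y : C) : F Y ↔ ∀ ⦃X : C⦄, T X → ∀ f : X ⟶ Y, f = 0 := by
  refine ⟨fun hY X hX f ↦ hTF.hom_eq_zero hX hY f, fun H ↦ ?_⟩
  obtain ⟨X', Y', i, p, h⟩ := hTF.exists_approximation Y
  have := h.epi
  have := h.shortExact.exact.mono_g (H h.1 i)
  have : IsIso p := isIso_of_mono_of_epi p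
  have := hTF.isClosedUnderIsomorphisms_right
  exact F.prop_of_iso (asIso p).symm h.2.1

theorem left_of_epi {X Y : C} (p : X ⟶ Y) [Epi p] (hX : T X) : T Y := by
  rw [hTF.left_iff]
  intro Z hZ f
  rw [← cancel_epi p, comp_zero]
  exact hTF.hom_eq_zero hX hZ _

theorem right_of_mono {X Y : C} (i : X ⟶ Y) [Mono i] (hY : F Y) : F X := by
  rw [hTF.right_iff]
  intro Z hZ f
  rw [← cancel_mono i, zero_comp]
  exact hTF.hom_eq_zero hZ hY _

theorem right_of_isZero {Y : C} (hY : IsZero Y) : F Y :=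
  (hTF.right_iff Y).2 fun _ _ _ ↦ hY.eq_of_tgt _ _

theorem left_of_isZero {Y : C} (hY : IsZero Y) : T Y :=
  (hTF.left_iff Y).2 fun _ _ _ ↦ hY.eq_of_src _ _

theorem isApproximation_id {X : C} (hX : T X) :
    IsApproximation T F (𝟙 X) (cokernel.π (𝟙 X)) :=
  ⟨hX, hTF.right_of_isZero (isZero_cokernel_of_epi _), cokernel.condition _,
    .mk' (ShortComplex.exact_of_g_is_cokernel _ (cokernelIsCokernel _)) inferInstance
      inferInstance⟩

theorem isApproximation_of_right {X : C} (hX : F X) :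
    IsApproximation T F (kernel.ι (𝟙 X)) (𝟙 X) :=
  ⟨hTF.left_of_isZero (isZero_kernel_of_mono _), hX, kernel.condition _,
    .mk' (ShortComplex.exact_of_f_is_kernel _ (kernelIsKernel _)) inferInstance
      inferInstance⟩

theorem isClosedUnderColimitsOfShape_left (J : Type*) [Category* J] :
    T.IsClosedUnderColimitsOfShape J where
  colimitsOfShape_le := by
    rintro X ⟨h⟩
    rw [hTF.left_iff]
    intro Y hY f
    exact h.isColimit.hom_ext fun j ↦ by
      rw [hTF.hom_eq_zero (h.prop_diag_obj j) hY (h.ι.app j ≫ f), comp_zero]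

theorem isLeftAdjoint_ι : T.ι.IsLeftAdjoint := by
  rw [isLeftAdjoint_iff_hasTerminal_costructuredArrow]
  intro M
  obtain ⟨X, Y, i, p, h⟩ := hTF.exists_approximation M
  have := h.mono
  have (A : CostructuredArrow T.ι M) :
      Unique (A ⟶ CostructuredArrow.mk (Y := ⟨X, h.1⟩) (by exact i)) :=
    have hg := h.exists_lift hTF A.left.property A.hom
    { default := CostructuredArrow.homMk (ObjectProperty.homMk hg.choose) hg.choose_spec
      uniq a := by
        ext
        rw [← cancel_mono i]
        exact (CostructuredArrow.w a).trans hg.choose_spec.symm }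
  exact hasTerminal_of_unique (CostructuredArrow.mk (Y := ⟨X, h.1⟩) (by exact i))

theorem isRightAdjoint_ι : F.ι.IsRightAdjoint := by
  rw [isRightAdjoint_iff_hasInitial_structuredArrow]
  intro M
  obtain ⟨X, Y, i, p, h⟩ := hTF.exists_approximation M
  have := h.epi
  have (A : StructuredArrow M F.ι) :
      Unique (StructuredArrow.mk (Y := ⟨Y, h.2.1⟩) (by exact p) ⟶ A) :=
    have hg := h.exists_desc hTF A.right.property A.hom
    { default := StructuredArrow.homMk (ObjectProperty.homMk hg.choose) hg.choose_spec
      uniq a := by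
        ext
        rw [← cancel_epi p]
        exact (StructuredArrow.w a).trans hg.choose_spec.symm }
  exact hasInitial_of_unique (StructuredArrow.mk (Y := ⟨Y, h.2.1⟩) (by exact p))

theorem exists_isApproximation_counit {R : C ⥤ T.FullSubcategory} (adj : T.ι ⊣ R) (M : C) :
    ∃ (Y : C) (p : M ⟶ Y),
      IsApproximation T F (X := (R.obj M).obj) (by exact adj.counit.app M) p := by
  obtain ⟨X, Y, i, p, h⟩ := hTF.exists_approximation M
  have := h.mono
  let ε : (R.obj M).obj ⟶ M := adj.counit.app M
  let a : (⟨X, h.1⟩ : T.FullSubcategory) ⟶ R.obj M := adj.homEquiv ⟨X, h.1⟩ M i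
  have ha : a.hom ≫ ε = i := (adj.homEquiv_counit _ _ a).symm.trans (Equiv.symm_apply_apply (adj.homEquiv ⟨X, h.1⟩ M) i)
  obtain ⟨b, hb⟩ := h.exists_lift hTF (R.obj M).property ε
  have hba : (ObjectProperty.homMk b : R.obj M ⟶ (⟨X, h.1⟩ : T.FullSubcategory)) ≫ a = 𝟙 _ := by
    apply (adj.homEquiv _ _).symm.injective
    rw [adj.homEquiv_counit, adj.homEquiv_counit]
    have : (b ≫ a.hom) ≫ ε = 𝟙 _ ≫ ε := by rw [Category.assoc, ha, hb, Category.id_comp]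
    exact this
  have hab : a.hom ≫ b = 𝟙 X := by rw [← cancel_mono i, Category.assoc, hb, ha, Category.id_comp]
  have hba' : b ≫ a.hom = 𝟙 _ := congr($(hba).hom)
  let e : (R.obj M).obj ≅ X := ⟨b, a.hom, hba', hab⟩
  have w : ε ≫ p = 0 := by rw [← hb, Category.assoc, h.comp_eq_zero, comp_zero]
  let e' : ShortComplex.mk i p h.comp_eq_zero ≅ ShortComplex.mk ε p w :=
    ShortComplex.isoMk e.symm (Iso.refl _) (Iso.refl _) (by simp [e, ha]) (by simp)
  exact ⟨Y, p, (R.obj M).property, h.2.1, w, ShortComplex.shortExact_of_iso e' h.shortExact⟩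

theorem exists_isApproximation_unit {L : C ⥤ F.FullSubcategory} (adj : L ⊣ F.ι) (M : C) :
    ∃ (X : C) (i : X ⟶ M),
      IsApproximation T F (Y := (L.obj M).obj) i (by exact adj.unit.app M) := by
  obtain ⟨X, Y, i, p, h⟩ := hTF.exists_approximation M
  have := h.epi
  let η : M ⟶ (L.obj M).obj := adj.unit.app M
  let a : L.obj M ⟶ (⟨Y, h.2.1⟩ : F.FullSubcategory) := (adj.homEquiv M ⟨Y, h.2.1⟩).symm p
  have ha : η ≫ a.hom = p := (adj.homEquiv_apply_eq a p).mpr rfl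
  obtain ⟨b, hb⟩ := h.exists_desc hTF (L.obj M).property η
  have hab : a ≫ (ObjectProperty.homMk b : (⟨Y, h.2.1⟩ : F.FullSubcategory) ⟶ L.obj M) = 𝟙 _ := by
    apply (adj.homEquiv _ _).injective
    rw [adj.homEquiv_unit, adj.homEquiv_unit]
    have : η ≫ a.hom ≫ b = η ≫ 𝟙 _ := by rw [reassoc_of% ha, hb, Category.comp_id]
    exact this
  have hba : b ≫ a.hom = 𝟙 Y := by rw [← cancel_epi p, reassoc_of% hb, ha, Category.comp_id]
  have hab' : a.hom ≫ b = 𝟙 _ := congr($(hab).hom)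
  let e : (L.obj M).obj ≅ Y := ⟨a.hom, b, hab', hba⟩
  have w : i ≫ η = 0 := by rw [← hb, ← Category.assoc, h.comp_eq_zero, zero_comp]
  let e' : ShortComplex.mk i p h.comp_eq_zero ≅ ShortComplex.mk i η w :=
    ShortComplex.isoMk (Iso.refl _) (Iso.refl _) e.symm (by simp) (by simp [e, hb])
  exact ⟨X, i, h.1, (L.obj M).property, w, ShortComplex.shortExact_of_iso e' h.shortExact⟩

theorem hasColimitsOfShape_left (J : Type*) [Category* J] [HasColimitsOfShape J C] :
    HasColimitsOfShape J T.FullSubcategory :=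
  have := hTF.isClosedUnderColimitsOfShape_left J
  inferInstance

theorem hasFiniteBiproducts_left : HasFiniteBiproducts T.FullSubcategory :=
  have : HasFiniteCoproducts T.FullSubcategory := ⟨fun _ ↦ hTF.hasColimitsOfShape_left _⟩
  .of_hasFiniteCoproducts

/-- Kernels in a torsion class are the torsion parts of the kernels in the ambient category. -/
theorem exists_isLimit_kernelFork {X Y : T.FullSubcategory} (f : X ⟶ Y) {K Z : C}
    {i : K ⟶ kernel f.hom} {p : kernel f.hom ⟶ Z} (h : IsApproximation T F i p) :
    ∃ (k : (⟨K, h.1⟩ : T.FullSubcategory) ⟶ X) (w : k ≫ f = 0),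
      Nonempty (IsLimit (KernelFork.ofι k w)) := by
  have := h.mono
  let k : (⟨K, h.1⟩ : T.FullSubcategory) ⟶ X := ObjectProperty.homMk (i ≫ kernel.ι f.hom)
  have w : k ≫ f = 0 := by
    ext
    exact (Category.assoc _ _ _).trans (by rw [kernel.condition, comp_zero]; rfl)
  refine ⟨k, w, ⟨KernelFork.IsLimit.ofι _ _ (fun {W} g hg ↦ ?_) ?_ ?_⟩⟩
  · exact ObjectProperty.homMk (h.exists_lift hTF W.property
      (kernel.lift f.hom g.hom congr($(hg).hom))).choose
  · intro W g hg
    ext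
    have := (h.exists_lift hTF W.property (kernel.lift f.hom g.hom congr($(hg).hom))).choose_spec
    simp [k, reassoc_of% this]
  · intro W g hg m hm
    ext
    rw [← cancel_mono i, ← cancel_mono (kernel.ι f.hom)]
    have := (h.exists_lift hTF W.property (kernel.lift f.hom g.hom congr($(hg).hom))).choose_spec
    rw [Category.assoc, Category.assoc]
    dsimp
    rw [reassoc_of% this, kernel.lift_ι, ← hm]
    rfl

theorem hasKernels_left : HasKernels T.FullSubcategory where
  has_limit f := by
    obtain ⟨K, Z, i, p, h⟩ := hTF.exists_approximation (kernel f.hom)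
    obtain ⟨k, w, ⟨hk⟩⟩ := hTF.exists_isLimit_kernelFork f h
    exact ⟨_, hk⟩

end IsTorsionPair

omit [Abelian C] in
theorem IsClosedUnderDirectLimits.isClosedUnderColimitsOfShape
    (hF : IsClosedUnderDirectLimits.{v} F) (J : Type v) [SmallCategory J] [IsFiltered J] :
    F.IsClosedUnderColimitsOfShape J where
  colimitsOfShape_le := by
    obtain ⟨J', _, _, _, G, _⟩ := IsFiltered.exists_directed J
    exact (F.colimitsOfShape_le_of_final G).trans (hF J').colimitsOfShape_le

/-- Used with `G` the coreflection onto `E` or the reflection onto `T`: a presentation of `X` in `C`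
is carried by `G` to one in the subcategory. -/
theorem exists_directLimit_of_functor (hC : IsLocallyFinitelyPresented.{v} C)
    (G : C ⥤ T.FullSubcategory) [PreservesFilteredColimitsOfSize.{v, v} G]
    (hG : ∀ B : C, IsFinitelyPresentable.{v} B → IsFinitelyPresentable.{v} (G.obj B))
    (X : T.FullSubcategory) (e : G.obj X.obj ≅ X) :
    ∃ (J : Type v) (_ : PartialOrder J) (_ : IsDirectedOrder J) (_ : Nonempty J),
      (ObjectProperty.isFinitelyPresentable.{v} T.FullSubcategory).colimitsOfShape J X := by
  obtain ⟨J, _, _, _, ⟨c⟩⟩ := hC.exists_directLimit X.obj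
  refine ⟨J, inferInstance, inferInstance, inferInstance, ⟨ObjectProperty.ColimitOfShape.ofIso
    { diag := c.diag ⋙ G, ι := _, isColimit := isColimitOfPreserves G c.isColimit,
      prop_diag_obj j := hG _ (c.prop_diag_obj j) } e⟩⟩

variable [IsGrothendieckAbelian.{v} C]

/-- If `F` is closed under direct limits, then the torsion radical of `(T, F)` commutes with
filtered colimits. -/
theorem IsTorsionPair.isFinitelyAccessible (hTF : IsTorsionPair T F)
    (hF : IsClosedUnderDirectLimits.{v} F) {R : C ⥤ T.FullSubcategory} (adj : T.ι ⊣ R) :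
    Functor.IsFinitelyAccessible.{v} R := by
  rw [Functor.IsFinitelyAccessible_iff_preservesFilteredColimitsOfSize]
  refine ⟨fun J _ _ ↦ ⟨fun {D} ↦ ?_⟩⟩
  have := hF.isClosedUnderColimitsOfShape J
  have := hTF.isClosedUnderColimitsOfShape_left J
  have := hTF.isClosedUnderIsomorphisms_right
  refine preservesColimit_of_preserves_colimit_cocone (colimit.isColimit D)
    (isColimitOfReflects T.ι ?_)
  let N := D ⋙ R ⋙ T.ι
  let ε : R ⋙ T.ι ⟶ 𝟭 C := adj.counit
  let α : N ⟶ D := Functor.whiskerLeft D ε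
  choose Y p hp using hTF.exists_isApproximation_counit adj
  have hε (M : C) : Mono (ε.app M) := (hp M).mono
  have : Mono α := by
    have (j : J) : Mono (α.app j) := hε _
    exact NatTrans.mono_of_mono_app α
  let S := ShortComplex.mk α (cokernel.π α) (cokernel.condition α)
  have hS : S.ShortExact :=
    .mk' (ShortComplex.exact_of_g_is_cokernel _ (cokernelIsCokernel α)) ‹_› inferInstance
  have hQ (j : J) : F ((cokernel α).obj j) := by
    have hj := hS.map_of_exact ((evaluation J C).obj j)
    exact F.prop_of_iso (IsColimit.coconePointUniqueUpToIso (hp (D.obj j)).shortExact.gIsCokernel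
      hj.gIsCokernel) (hp (D.obj j)).2.1
  -- Filtered colimits are exact and both classes are closed under them, so the colimit of the
  -- approximation sequences is again one; uniqueness does the rest.
  have happ : IsApproximation T F (colim.map α) (colim.map (cokernel.π α)) :=
    ⟨T.prop_colimit N (fun j ↦ (R.obj (D.obj j)).property), F.prop_colimit _ hQ, _,
      hS.map_of_exact colim⟩
  let c : Cocone N := T.ι.mapCocone (R.mapCocone (colimit.cocone D))
  have fac : colimit.desc N c ≫ ε.app (colimit D) = colim.map α := by
    refine colimit.hom_ext (fun j ↦ ?_)
    rw [colimit.ι_desc_assoc, colimit.ι_map]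
    exact ε.naturality (colimit.ι D j)
  have : IsIso ((colimit.isColimit N).desc c) := by
    obtain ⟨e, he⟩ := happ.exists_iso_left hTF (hp (colimit D))
    have : colimit.desc N c = e.hom := by
      have := hε (colimit D)
      rw [← cancel_mono (ε.app (colimit D)), fac]
      exact he.symm
    change IsIso (colimit.desc N c)
    rw [this]
    infer_instance
  exact IsColimit.ofPointIso (colimit.isColimit N)

/-- If `F` is closed under direct limits, the objects finitely presented in the torsion class are
those finitely presented in the ambient category. -/
theorem IsTorsionPair.isFinitelyPresentable_obj_iff (hTF : IsTorsionPair T F)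
    (hF : IsClosedUnderDirectLimits.{v} F) (X : T.FullSubcategory) :
    IsFinitelyPresentable.{v} X.obj ↔ IsFinitelyPresentable.{v} X := by
  have := hTF.isLeftAdjoint_ι
  constructor
  · intro h
    refine isFinitelyPresentable_of_directed X (fun J _ _ _ D c hc ↦ ?_)
    have hc' := isColimitOfPreserves T.ι hc
    refine ⟨fun f ↦ ?_, fun j g hg ↦ ?_⟩
    · obtain ⟨j, g, hg⟩ := IsFinitelyPresentable.exists_hom_of_isColimit hc' f.hom
      exact ⟨j, ObjectProperty.homMk g, by ext; exact hg⟩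
    · obtain ⟨k, u, hu⟩ := isFinitelyPresentable_exists_zero h hc' g.hom congr($(hg).hom)
      exact ⟨k, u, by ext; exact hu⟩
  · intro h
    let adj := Adjunction.ofIsLeftAdjoint T.ι
    have := hTF.isFinitelyAccessible hF adj
    exact adj.isCardinalPresentable_leftAdjoint_obj _ X

/-- A description of the quasi locally coherent torsion classes of finite type. -/
theorem IsTorsionPair.isQuasiLocallyCoherent_iff (hTF : IsTorsionPair T F)
    (hF : IsClosedUnderDirectLimits.{v} F) :
    IsQuasiLocallyCoherent.{v} T.FullSubcategory ↔
      IsLocallyFinitelyPresented.{v} T.FullSubcategory ∧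
      ∀ ⦃X Y K Z : C⦄ (f : X ⟶ Y) (i : K ⟶ kernel f) (p : kernel f ⟶ Z), T X → T Y →
        IsFinitelyPresentable.{v} X → IsFinitelyPresentable.{v} Y → IsApproximation T F i p →
        IsFinitelyPresentable.{v} K := by
  constructor
  · intro h
    refine ⟨h.1, fun X Y K Z f i p hX hY hX' hY' hip ↦ ?_⟩
    let f' : (⟨X, hX⟩ : T.FullSubcategory) ⟶ ⟨Y, hY⟩ := ObjectProperty.homMk f
    obtain ⟨k, w, ⟨hk⟩⟩ := hTF.exists_isLimit_kernelFork f' hip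
    have := h.2
    exact (hTF.isFinitelyPresentable_obj_iff hF _).2 (ObjectProperty.prop_of_isLimit_kernelFork
      (ObjectProperty.isFinitelyPresentable.{v} T.FullSubcategory) hk
      ((hTF.isFinitelyPresentable_obj_iff hF _).1 hX')
      ((hTF.isFinitelyPresentable_obj_iff hF _).1 hY'))
  · rintro ⟨h₁, h₂⟩
    refine ⟨h₁, ⟨?_⟩⟩
    rintro _ ⟨f, k, hk, hX, hY⟩
    obtain ⟨K, Z, i, p, h⟩ := hTF.exists_approximation (kernel f.hom)
    obtain ⟨k', w, ⟨hk'⟩⟩ := hTF.exists_isLimit_kernelFork f h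
    refine isFinitelyPresentable_of_iso (IsLimit.conePointUniqueUpToIso hk' hk)
      ((hTF.isFinitelyPresentable_obj_iff hF _).1 ?_)
    exact h₂ f.hom i p (ObjectProperty.FullSubcategory.property _)
      (ObjectProperty.FullSubcategory.property _)
      ((hTF.isFinitelyPresentable_obj_iff hF _).2 hX)
      ((hTF.isFinitelyPresentable_obj_iff hF _).2 hY) h

theorem IsTorsionPair.isLocallyFinitelyPresented (hTF : IsTorsionPair T F)
    (hF : IsClosedUnderDirectLimits.{v} F) (hC : IsLocallyFinitelyPresented.{v} C)
    (h : ∀ X : T.FullSubcategory, ∃ (J : Type v) (_ : PartialOrder J) (_ : IsDirectedOrder J)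
      (_ : Nonempty J),
      (ObjectProperty.isFinitelyPresentable.{v} T.FullSubcategory).colimitsOfShape J X) :
    IsLocallyFinitelyPresented.{v} T.FullSubcategory := by
  refine ⟨hTF.hasFiniteBiproducts_left, hTF.hasKernels_left,
    fun J _ _ _ ↦ hTF.hasColimitsOfShape_left J, ?_, h⟩
  have := hC.essentiallySmall_fp
  have := hTF.isClosedUnderIsomorphisms_left
  let P : ObjectProperty C := ObjectProperty.isFinitelyPresentable.{v} C ⊓ T
  have : ObjectProperty.EssentiallySmall.{v} P :=
    .of_le (Q := ObjectProperty.isFinitelyPresentable.{v} C) inf_le_left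
  obtain ⟨Q, _, hQ, hPQ⟩ := ObjectProperty.EssentiallySmall.exists_small_le P
  refine ⟨.ofObj (fun X : Subtype Q ↦ (⟨X.1, (hQ _ X.2).2⟩ : T.FullSubcategory)), inferInstance,
    fun X hX ↦ ?_⟩
  obtain ⟨Y, hY, ⟨e⟩⟩ := hPQ X.obj ⟨(hTF.isFinitelyPresentable_obj_iff hF X).2 hX, X.property⟩
  exact ⟨⟨Y, (hQ _ hY).2⟩, ObjectProperty.ofObj_apply
    (fun X : Subtype Q ↦ (⟨X.1, (hQ _ X.2).2⟩ : T.FullSubcategory)) ⟨Y, hY⟩,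
    ⟨ObjectProperty.isoMk _ e⟩⟩

end Torsion

/-! ### Kernels along short exact sequences -/

section Kernels

variable {C : Type u} [Category.{v} C] [Abelian C]

theorem shortExact_kernel {X Y : C} (p : X ⟶ Y) [Epi p] :
    (ShortComplex.mk (kernel.ι p) p (kernel.condition p)).ShortExact :=
  .mk' (ShortComplex.exact_of_f_is_kernel _ (kernelIsKernel p)) inferInstance ‹_›

theorem isFinitelyPresentable_kernel_of_fac {X Y Z : C} {f : X ⟶ Y} {m : Y ⟶ Z} [Mono m]
    {g : X ⟶ Z} (hg : f ≫ m = g) (h : IsFinitelyPresentable.{v} (kernel f)) :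
    IsFinitelyPresentable.{v} (kernel g) := by
  subst hg
  exact isFinitelyPresentable_of_iso (kernelCompMono f m).symm h

/-- For a short exact sequence `0 ⟶ X ⟶ B ⟶ Y ⟶ 0` and `f : B ⟶ M`, the kernel of `f` is an
extension of a kernel of `Y ⟶ coker (X ⟶ M)` by the kernel of `X ⟶ M`. -/
theorem exists_shortExact_kernel {X B Y M : C} {i : X ⟶ B} {p : B ⟶ Y} {h : i ≫ p = 0}
    (hS : (ShortComplex.mk i p h).ShortExact) (f : B ⟶ M) :
    ∃ (w : Y ⟶ cokernel (i ≫ f)) (u : kernel (i ≫ f) ⟶ kernel f) (v : kernel f ⟶ kernel w)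
      (huv : u ≫ v = 0), (ShortComplex.mk u v huv).ShortExact := by
  have : Mono i := hS.mono_f
  have : Epi p := hS.epi_g
  let c := cokernel.π (i ≫ f)
  have hc : i ≫ f ≫ c = 0 := by rw [← Category.assoc, cokernel.condition]
  let w : Y ⟶ cokernel (i ≫ f) := hS.exact.desc (f ≫ c) hc
  have hw : p ≫ w = f ≫ c := hS.exact.g_desc _ hc
  let u : kernel (i ≫ f) ⟶ kernel f :=
    kernel.lift f (kernel.ι _ ≫ i) (by rw [Category.assoc, kernel.condition])
  have hu : u ≫ kernel.ι f = kernel.ι _ ≫ i := kernel.lift_ι _ _ _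
  let v : kernel f ⟶ kernel w :=
    kernel.lift w (kernel.ι f ≫ p) (by rw [Category.assoc, hw, kernel.condition_assoc, zero_comp])
  have hv : v ≫ kernel.ι w = kernel.ι f ≫ p := kernel.lift_ι _ _ _
  have huv : u ≫ v = 0 := by
    rw [← cancel_mono (kernel.ι w), Category.assoc, hv, reassoc_of% hu, h, comp_zero, zero_comp]
  have : Mono u := by
    have : Mono (u ≫ kernel.ι f) := by
      rw [hu]
      infer_instance
    exact mono_of_mono u (kernel.ι f)
  refine ⟨w, u, v, huv, .mk' (ShortComplex.exact_of_f_is_kernel _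
    (KernelFork.IsLimit.ofι' _ _ fun {W} k hk ↦ ?_)) ‹_› ?_⟩
  · dsimp at k hk
    have hkp : (k ≫ kernel.ι f) ≫ p = 0 := by
      rw [Category.assoc, ← hv, reassoc_of% hk, zero_comp]
    have hl : hS.exact.lift _ hkp ≫ i = k ≫ kernel.ι f := hS.exact.lift_f _ _
    refine ⟨kernel.lift (i ≫ f) (hS.exact.lift _ hkp) (by
      rw [reassoc_of% hl, kernel.condition, comp_zero]), ?_⟩
    dsimp
    rw [← cancel_mono (kernel.ι f), Category.assoc, hu, kernel.lift_ι_assoc, hl]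
  · dsimp
    -- Diagram chase: lift `y` to `b` in `B`; then `b ≫ f` dies in the cokernel, so after refinement
    -- it comes from `X`, and subtracting that part puts `b` in the kernel of `f`.
    rw [epi_iff_surjective_up_to_refinements]
    intro A y
    obtain ⟨A', π, _, b, hb⟩ := surjective_up_to_refinements_of_epi p (y ≫ kernel.ι w)
    have hbc : (b ≫ f) ≫ c = 0 := by
      rw [Category.assoc, ← hw, ← reassoc_of% hb, kernel.condition, comp_zero, comp_zero]
    obtain ⟨A'', π', _, x, hx⟩ := (ShortComplex.exact_of_g_is_cokernel
      (ShortComplex.mk (i ≫ f) c (cokernel.condition _))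
      (cokernelIsCokernel _)).exact_up_to_refinements (b ≫ f) hbc
    dsimp at x hx
    refine ⟨A'', π' ≫ π, inferInstance, kernel.lift f (π' ≫ b - x ≫ i) (by
      rw [Preadditive.sub_comp, Category.assoc, Category.assoc, hx, sub_self]), ?_⟩
    rw [← cancel_mono (kernel.ι w), Category.assoc, Category.assoc, Category.assoc, hb, hv,
      kernel.lift_ι_assoc, Preadditive.sub_comp, Category.assoc, Category.assoc, h, comp_zero,
      sub_zero]

end Kernels

/-! ### TTF triples of finite type and the equivalences -/

section TTF

variable {C : Type u} [Category.{v} C] [Abelian C] [IsGrothendieckAbelian.{v} C]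
  {E T F : ObjectProperty C}

theorem IsTorsionPair.extOneCommutesWithDirectLimits (hTF : IsTorsionPair T F)
    (hF : IsClosedUnderDirectLimits.{v} F) {S : ObjectProperty C}
    (h : ExtOneCommutesWithDirectLimits.{v} T S) {P : C} (hP : T P)
    (hP' : IsFinitelyPresentable.{v} P) {J : Type v} [PartialOrder J] [IsDirectedOrder J]
    [Nonempty J] {D : J ⥤ C} (hD : ∀ j, S (D.obj j)) {c : Cocone D} (hc : IsColimit c) :
    (∀ x : Ext.{v} P c.pt 1, ∃ (j : J) (y : Ext.{v} P (D.obj j) 1),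
      y.comp (Ext.mk₀ (c.ι.app j)) (add_zero 1) = x) ∧
    (∀ (j : J) (y : Ext.{v} P (D.obj j) 1), y.comp (Ext.mk₀ (c.ι.app j)) (add_zero 1) = 0 →
      ∃ (k : J) (u : j ⟶ k), y.comp (Ext.mk₀ (D.map u)) (add_zero 1) = 0) :=
  (preservesColimit_extFunctorObj_iff hc P).1
    (h ⟨P, hP⟩ ((hTF.isFinitelyPresentable_obj_iff hF ⟨P, hP⟩).1 hP') J D hD)

theorem IsTorsionPair.exists_isColimit (hTF : IsTorsionPair T F)
    (hF : IsClosedUnderDirectLimits.{v} F)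
    (h : IsLocallyFinitelyPresented.{v} T.FullSubcategory) {X : C} (hX : T X) :
    ∃ (J : Type v) (_ : PartialOrder J) (_ : IsDirectedOrder J) (_ : Nonempty J) (D : J ⥤ C)
      (a : D ⟶ (Functor.const J).obj X) (_ : IsColimit (Cocone.mk X a)),
      ∀ j, T (D.obj j) ∧ IsFinitelyPresentable.{v} (D.obj j) := by
  obtain ⟨J, _, _, _, ⟨c⟩⟩ := h.exists_directLimit ⟨X, hX⟩
  have := hTF.isLeftAdjoint_ι
  exact ⟨J, inferInstance, inferInstance, inferInstance, c.diag ⋙ T.ι, _,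
    isColimitOfPreserves T.ι c.isColimit, fun j ↦ ⟨(c.diag.obj j).property,
      (hTF.isFinitelyPresentable_obj_iff hF _).2 (c.prop_diag_obj j)⟩⟩

namespace IsTTFTripleOfFiniteType

variable (h : IsTTFTripleOfFiniteType.{v} E T F)

include h

omit [IsGrothendieckAbelian.{v} C] in
theorem isClosedUnderDirectLimits : IsClosedUnderDirectLimits.{v} T :=
  fun J _ _ _ ↦ h.right.isClosedUnderColimitsOfShape_left J

/-- The reflection onto `T` is left adjoint to an inclusion that itself preserves colimits, so it
preserves finite presentation. -/
theorem isFinitelyPresentable_right {X B Y : C} {i : X ⟶ B} {p : B ⟶ Y}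
    (hip : IsApproximation E T i p) (hB : IsFinitelyPresentable.{v} B) :
    IsFinitelyPresentable.{v} Y := by
  have := h.left.isRightAdjoint_ι
  have := h.right.isLeftAdjoint_ι
  let adj := Adjunction.ofIsRightAdjoint T.ι
  obtain ⟨X', i', hi'⟩ := h.left.exists_isApproximation_unit adj B
  obtain ⟨e, -⟩ := hi'.exists_iso_right h.left hip
  exact isFinitelyPresentable_of_iso e ((h.right.isFinitelyPresentable_obj_iff h.finiteType _).2
    (adj.isCardinalPresentable_leftAdjoint_obj _ B))

section Kernel

variable (hE : IsQuasiLocallyCoherent.{v} E.FullSubcategory)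
  (hT : IsQuasiLocallyCoherent.{v} T.FullSubcategory)
  (hET : ExtOneCommutesWithDirectLimits.{v} E T)

include hET

/-- For `Z` in `T`, `Hom(Y, Z) = Hom(K, Z)` and `Hom(P, Z) = 0`, so `Hom(Y, Z)` is the kernel of
`Ext¹(I, Z) ⟶ Ext¹(P, Z)`. Both terms commute with direct limits in `T`. -/
theorem isFinitelyPresentable_right_of_shortExact {K P I X Y : C} {k : K ⟶ P} {q : P ⟶ I}
    {w : k ≫ q = 0} (hS : (ShortComplex.mk k q w).ShortExact) (hP : E P) (hI : E I)
    (hP' : IsFinitelyPresentable.{v} P) (hI' : IsFinitelyPresentable.{v} I) {i : X ⟶ K}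
    {p : K ⟶ Y} (hip : IsApproximation E T i p) : IsFinitelyPresentable.{v} Y := by
  have := hip.epi
  have := h.right.isLeftAdjoint_ι
  refine (h.right.isFinitelyPresentable_obj_iff h.finiteType ⟨Y, hip.2.1⟩).2
    (isFinitelyPresentable_of_directed _ fun J _ _ _ D c hc ↦ ?_)
  have hc' := isColimitOfPreserves T.ι hc
  have hPz {Z : T.FullSubcategory} (f : P ⟶ Z.obj) : f = 0 := h.left.hom_eq_zero hP Z.property f
  have hKz {Z : T.FullSubcategory} (f : K ⟶ Z.obj)
      (hf : hS.extClass.comp (Ext.mk₀ f) (add_zero 1) = 0) : f = 0 := by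
    obtain ⟨g, hg⟩ := exists_extension hS f hf
    rw [← hg, hPz g, comp_zero]
  have extI := h.left.extOneCommutesWithDirectLimits h.isClosedUnderDirectLimits hET hI hI'
    (D := D ⋙ T.ι) (fun j ↦ (D.obj j).property) hc'
  have extP := h.left.extOneCommutesWithDirectLimits h.isClosedUnderDirectLimits hET hP hP'
    (D := D ⋙ T.ι) (fun j ↦ (D.obj j).property) hc'
  refine ⟨fun f ↦ ?_, fun j g hg ↦ ?_⟩
  · let f' : K ⟶ c.pt.obj := p ≫ f.hom
    obtain ⟨j, y, hy⟩ := extI.1 (hS.extClass.comp (Ext.mk₀ f') (add_zero 1))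
    obtain ⟨l, u, hu⟩ := extP.2 j ((Ext.mk₀ q).comp y (zero_add 1)) (by
      rw [Ext.comp_assoc_of_third_deg_zero, hy]
      exact hS.comp_extClass_assoc _ _)
    rw [Ext.comp_assoc_of_third_deg_zero] at hu
    obtain ⟨g, hg⟩ := exists_eq_extClass_comp hS _ hu
    change K ⟶ (D.obj l).obj at g
    let b : K ⟶ c.pt.obj := g ≫ (c.ι.app l).hom
    -- `g` was chosen through its connecting class only; injectivity of the connecting map turns
    -- equality of classes into equality of morphisms.
    have hgf : b - f' = 0 := hKz (Z := c.pt) _ (by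
      have h₁ : hS.extClass.comp (Ext.mk₀ b) (add_zero 1) =
          hS.extClass.comp (Ext.mk₀ f') (add_zero 1) := by
        change hS.extClass.comp (Ext.mk₀ (g ≫ (c.ι.app l).hom)) (add_zero 1) = _
        rw [← Ext.mk₀_comp_mk₀, ← Ext.comp_assoc_of_third_deg_zero]
        refine (congrArg (fun z ↦ Ext.comp z (Ext.mk₀ (c.ι.app l).hom) (add_zero 1)) hg).trans ?_
        rw [Ext.comp_assoc_of_third_deg_zero, Ext.mk₀_comp_mk₀]
        refine Eq.trans ?_ hy
        congr 2
        exact (T.ι.mapCocone c).w u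
      rw [sub_eq_add_neg, Ext.mk₀_add, Ext.mk₀_neg, Ext.comp_add, Ext.comp_neg, h₁,
        add_neg_cancel])
    obtain ⟨g', hg'⟩ := hip.exists_desc h.left (D.obj l).property g
    refine ⟨l, ObjectProperty.homMk g', ?_⟩
    ext
    dsimp
    rw [← cancel_epi p, reassoc_of% hg']
    exact sub_eq_zero.1 hgf
  · let g' : K ⟶ (D.obj j).obj := p ≫ g.hom
    have hg' : g' ≫ (c.ι.app j).hom = 0 := by
      have : g.hom ≫ (c.ι.app j).hom = 0 := congr($(hg).hom)
      rw [Category.assoc, this, comp_zero]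
    obtain ⟨l, u, hu⟩ := extI.2 j (hS.extClass.comp (Ext.mk₀ g') (add_zero 1)) (by
      rw [Ext.comp_assoc_of_third_deg_zero, Ext.mk₀_comp_mk₀]
      refine (congrArg (fun z ↦ hS.extClass.comp (Ext.mk₀ z) (add_zero 1)) hg').trans ?_
      rw [Ext.mk₀_zero, Ext.comp_zero])
    rw [Ext.comp_assoc_of_third_deg_zero, Ext.mk₀_comp_mk₀] at hu
    have := hKz (Z := D.obj l) _ hu
    refine ⟨l, u, ?_⟩
    ext
    rw [← cancel_epi p]
    exact (Category.assoc _ _ _).symm.trans (this.trans comp_zero.symm)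

include hE

theorem isFinitelyPresentable_kernel_left_left {P P' : C} (g : P ⟶ P') (hP : E P) (hP' : E P')
    (hPf : IsFinitelyPresentable.{v} P) (hPf' : IsFinitelyPresentable.{v} P') :
    IsFinitelyPresentable.{v} (kernel g) := by
  have H := ((h.left.isQuasiLocallyCoherent_iff h.isClosedUnderDirectLimits).1 hE).2
  let q := Abelian.factorThruImage g
  have hI : E (Abelian.image g) := h.left.left_of_epi q hP
  -- The image is the kernel of `P' ⟶ coker g` and lies in `E`, so it is also the kernel taken in
  -- `E`.
  have hI' : IsFinitelyPresentable.{v} (Abelian.image g) :=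
    H (cokernel.π g) (𝟙 _) _ hP' (h.left.left_of_epi (cokernel.π g) hP') hPf'
      (isFinitelyPresentable_cokernel g hPf hPf') (h.left.isApproximation_id hI)
  obtain ⟨X, Y, i, p, hip⟩ := h.left.exists_approximation (kernel q)
  refine isFinitelyPresentable_kernel_of_fac (Abelian.image.fac g)
    (isFinitelyPresentable_of_shortExact hip.shortExact (H q i p hP hI hPf hI' hip) ?_)
  exact h.isFinitelyPresentable_right_of_shortExact hET (shortExact_kernel q) hP hI hPf hI' hip

omit hE
include hT

theorem isFinitelyPresentable_kernel_right_left {L Z : C} (g : L ⟶ Z) (hL : T L) (hZ : E Z)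
    (hL' : IsFinitelyPresentable.{v} L) (hZ' : IsFinitelyPresentable.{v} Z) :
    IsFinitelyPresentable.{v} (kernel g) := by
  have H := ((h.right.isQuasiLocallyCoherent_iff h.finiteType).1 hT).2
  let q := Abelian.factorThruImage g
  have hI : T (Abelian.image g) := h.right.left_of_epi q hL
  -- As a quotient of `L` the image lies in `T`. It is also the kernel of an epimorphism in `fp(E)`,
  -- and it equals its own `T`-part.
  have hI' : IsFinitelyPresentable.{v} (Abelian.image g) :=
    h.isFinitelyPresentable_right_of_shortExact hET (shortExact_kernel (cokernel.π g)) hZ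
      (h.left.left_of_epi (cokernel.π g) hZ) hZ' (isFinitelyPresentable_cokernel g hL' hZ')
      (h.left.isApproximation_of_right hI)
  exact isFinitelyPresentable_kernel_of_fac (Abelian.image.fac g) (H q (𝟙 _) _ hL hI hL' hI'
    (h.right.isApproximation_id (h.left.right_of_mono (kernel.ι q) hL)))

variable (hr : RestrictsToFP.{v} E T)
include hr

/-- Two stages: the kernel of `L ⟶ y(M)` is taken within `T`, and `f` maps it into `x(M)`, where the
case of a morphism from `T` to `E` applies. -/
theorem isFinitelyPresentable_kernel_right {L M : C} (f : L ⟶ M) (hL : T L)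
    (hL' : IsFinitelyPresentable.{v} L) (hM : IsFinitelyPresentable.{v} M) :
    IsFinitelyPresentable.{v} (kernel f) := by
  have H := ((h.right.isQuasiLocallyCoherent_iff h.finiteType).1 hT).2
  obtain ⟨X, Y, i, p, hip⟩ := h.left.exists_approximation M
  obtain ⟨hX, hY⟩ := hr i p hip hM
  have := hip.mono
  have hK : T (kernel (f ≫ p)) := h.left.right_of_mono (kernel.ι _) hL
  have hK' : IsFinitelyPresentable.{v} (kernel (f ≫ p)) :=
    H (f ≫ p) (𝟙 _) _ hL hip.2.1 hL' hY (h.right.isApproximation_id hK)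
  have hl : (kernel.ι (f ≫ p) ≫ f) ≫ p = 0 := by rw [Category.assoc, kernel.condition]
  let l : kernel (f ≫ p) ⟶ X := hip.shortExact.exact.lift _ hl
  have hl' : l ≫ i = kernel.ι (f ≫ p) ≫ f := hip.shortExact.exact.lift_f _ hl
  have w : (kernel.ι l ≫ kernel.ι (f ≫ p)) ≫ f = 0 := by
    rw [Category.assoc, ← hl', kernel.condition_assoc, zero_comp]
  have hlim : IsLimit (KernelFork.ofι _ w) := KernelFork.IsLimit.ofι' _ _ (fun {W} k hk ↦
    ⟨kernel.lift l (kernel.lift (f ≫ p) k (by rw [reassoc_of% hk, zero_comp])) (by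
      rw [← cancel_mono i, Category.assoc, hl', kernel.lift_ι_assoc, hk, zero_comp]), by simp⟩)
  exact isFinitelyPresentable_of_iso ((kernelIsKernel f).conePointUniqueUpToIso hlim).symm
    (h.isFinitelyPresentable_kernel_right_left hT hET l hK hip.1 hK' hX)

include hE

/-- Under the conditions of (c), the finitely presented objects are closed under kernels. -/
theorem isClosedUnderKernels :
    (ObjectProperty.isFinitelyPresentable.{v} C).IsClosedUnderKernels := by
  refine isClosedUnderKernels_of_kernel (fun B M f hB hM ↦ ?_)
  obtain ⟨X, Y, i, p, hip⟩ := h.left.exists_approximation B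
  obtain ⟨hX, hY⟩ := hr i p hip hB
  obtain ⟨X', Y', i', p', hip'⟩ := h.left.exists_approximation M
  obtain ⟨hX', hY'⟩ := hr i' p' hip' hM
  have := hip'.mono
  obtain ⟨w, a, b, hab, hS⟩ := exists_shortExact_kernel hip.shortExact f
  obtain ⟨g, hg⟩ := hip'.exists_lift h.left hip.1 (i ≫ f)
  exact isFinitelyPresentable_of_shortExact hS
    (isFinitelyPresentable_kernel_of_fac hg
      (h.isFinitelyPresentable_kernel_left_left hE hET g hip.1 hip'.1 hX hX'))
    (h.isFinitelyPresentable_kernel_right hT hET hr w hip.2.1 hY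
      (isFinitelyPresentable_cokernel _ hX hM))

end Kernel

/-- With `X` the colimit of `D` in `fp(E)`, the class of the sequence descends to some `D.obj j`.
Its pullback to `B` dies in the colimit, hence at a stage `k`, which yields `r : X ⟶ D.obj k`. -/
theorem restrictsToFP (hB : ConditionB.{v} E T) : RestrictsToFP.{v} E T := by
  intro X B Y i p hip hBf
  have hY := h.isFinitelyPresentable_right hip hBf
  refine ⟨?_, hY⟩
  obtain ⟨J, _, _, _, D, a, hc, hD⟩ := h.left.exists_isColimit h.isClosedUnderDirectLimits
    hB.1.1.isLocallyFinitelyPresented hip.1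
  have hS := hip.shortExact
  obtain ⟨j, y, hy⟩ := (h.right.extOneCommutesWithDirectLimits h.finiteType hB.2.2 hip.2.1 hY
    (fun j ↦ (hD j).1) hc).1 hS.extClass
  obtain ⟨k, u, hu⟩ := ext_exists_eq_zero hBf hc ((Ext.mk₀ p).comp y (zero_add 1)) (by
    rw [Ext.comp_assoc_of_third_deg_zero, hy]
    exact hS.comp_extClass)
  rw [Ext.comp_assoc_of_third_deg_zero] at hu
  obtain ⟨r, hr⟩ := exists_eq_extClass_comp hS _ hu
  change X ⟶ D.obj k at r
  have w (k : J) (u : j ⟶ k) : D.map u ≫ a.app k = a.app j := (Cocone.mk X a).w u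
  let b : X ⟶ X := r ≫ a.app k
  -- `b` fixes the extension class, so `b - 𝟙 X` extends along `i` to `g : B ⟶ X`. As `g` also
  -- factors through a term of the system, so does `𝟙 X = b - i ≫ g`.
  obtain ⟨g, hg⟩ := exists_extension hS (b - 𝟙 X) (by
    have h₁ : hS.extClass.comp (Ext.mk₀ b) (add_zero 1) = hS.extClass := by
      change hS.extClass.comp (Ext.mk₀ (r ≫ a.app k)) (add_zero 1) = _
      rw [← Ext.mk₀_comp_mk₀, ← Ext.comp_assoc_of_third_deg_zero]
      refine (congrArg (fun z ↦ Ext.comp z (Ext.mk₀ (a.app k)) (add_zero 1)) hr).trans ?_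
      rw [Ext.comp_assoc_of_third_deg_zero, Ext.mk₀_comp_mk₀, w, hy]
    rw [sub_eq_add_neg, Ext.mk₀_add, Ext.mk₀_neg, Ext.comp_add, Ext.comp_neg, h₁,
      Ext.comp_mk₀_id, add_neg_cancel])
  obtain ⟨l, g', hg'⟩ := IsFinitelyPresentable.exists_hom_of_isColimit hc g
  dsimp at g g' hg hg'
  refine isFinitelyPresentable_of_retract
    (r ≫ D.map (IsFiltered.leftToMax k l) - i ≫ g' ≫ D.map (IsFiltered.rightToMax k l))
    (a.app (IsFiltered.max k l)) ?_ (hD _).2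
  have h₁ := (Cocone.mk X a).w (IsFiltered.leftToMax k l)
  have h₂ := (Cocone.mk X a).w (IsFiltered.rightToMax k l)
  dsimp at h₁ h₂
  rw [Preadditive.sub_comp, Category.assoc, Category.assoc, Category.assoc]
  rw [h₁, h₂, hg', hg]
  exact sub_sub_cancel b _

theorem isSeparating (hB : ConditionB.{v} E T) :
    (ObjectProperty.isFinitelyPresentable.{v} C).IsSeparating := by
  rw [Preadditive.isSeparating_iff]
  intro M N f H
  obtain ⟨X, Y, i, p, hip⟩ := h.left.exists_approximation M
  have hS := hip.shortExact
  obtain ⟨J, _, _, _, D, a, hc, hD⟩ := h.left.exists_isColimit h.isClosedUnderDirectLimits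
    hB.1.1.isLocallyFinitelyPresented hip.1
  obtain ⟨J', _, _, _, D', a', hc', hD'⟩ := h.right.exists_isColimit h.finiteType
    hB.1.2.isLocallyFinitelyPresented hip.2.1
  have hif : i ≫ f = 0 := hc.hom_ext fun j ↦ by
    have := H _ (hD j).2 (a.app j ≫ i)
    rw [Category.assoc] at this
    exact this.trans comp_zero.symm
  have := hS.epi_g
  have hf' : p ≫ hS.exact.desc f hif = f := hS.exact.g_desc f hif
  generalize hS.exact.desc f hif = f' at hf'
  change Y ⟶ N at f'
  have : f' = 0 := hc'.hom_ext fun j ↦ by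
    let q : D'.obj j ⟶ Y := a'.app j
    change q ≫ f' = q ≫ 0
    -- The pullback of the sequence along `q` is a class that descends to `Ext¹(D'.obj j, D.obj k)`.
    -- The corresponding extension `B` is finitely presented, covers `D'.obj j`, and maps to `M`
    -- over `q`, so `f` is tested on it.
    obtain ⟨k, y, hy⟩ := (h.right.extOneCommutesWithDirectLimits h.finiteType hB.2.2 (hD' j).1
      (hD' j).2 (fun j ↦ (hD j).1) hc).1 ((Ext.mk₀ q).comp hS.extClass (zero_add 1))
    obtain ⟨B, i', r, w, hS', hr⟩ := exists_shortExact_comp_eq_zero y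
    have : Epi r := hS'.epi_g
    obtain ⟨b, hb⟩ := exists_lift hS (r ≫ q) (by
      rw [← Ext.mk₀_comp_mk₀_assoc, ← hy, ← Ext.comp_assoc_of_third_deg_zero, hr, Ext.zero_comp])
    dsimp at b hb
    rw [← cancel_epi r, ← Category.assoc, ← hb, Category.assoc, hf', comp_zero, comp_zero]
    exact H _ (isFinitelyPresentable_of_shortExact hS' (hD k).2 (hD' j).2) b
  rw [← hf', this, comp_zero]

theorem conditionC_of_conditionB (hB : ConditionB.{v} E T) : ConditionC.{v} E T :=
  ⟨hB.1, hB.2.1, h.restrictsToFP hB⟩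

theorem isLocallyCoherent_of_conditionC (hC : IsLocallyFinitelyPresented.{v} C)
    (hc : ConditionC.{v} E T) : IsLocallyCoherent.{v} C :=
  have := h.isClosedUnderKernels hc.1.1 hc.1.2 hc.2.1 hc.2.2
  ⟨hC, nonempty_abelian_of_isClosedUnderKernels⟩

theorem isLocallyCoherent_of_conditionB (hB : ConditionB.{v} E T) : IsLocallyCoherent.{v} C :=
  h.isLocallyCoherent_of_conditionC (isLocallyFinitelyPresented_of_isSeparating (h.isSeparating hB))
    (h.conditionC_of_conditionB hB)

theorem conditionB_of_isLocallyCoherent (hC : IsLocallyCoherent.{v} C) : ConditionB.{v} E T := by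
  have hK := isClosedUnderKernels_of_isLocallyCoherent hC
  have hr : RestrictsToFP.{v} E T := fun X B Y i p hip hB ↦ by
    have hY := h.isFinitelyPresentable_right hip hB
    exact ⟨isFinitelyPresentable_of_iso
      ((kernelIsKernel p).conePointUniqueUpToIso hip.shortExact.fIsKernel)
      (isFinitelyPresentable_kernel p hB hY), hY⟩
  have := h.left.isLeftAdjoint_ι
  have := h.left.isRightAdjoint_ι
  have := h.right.isLeftAdjoint_ι
  have hTE := h.isClosedUnderDirectLimits
  refine ⟨⟨?_, ?_⟩, fun P hP J _ _ _ D _ ↦ ?_, fun P hP J _ _ _ D _ ↦ ?_⟩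
  · refine (h.left.isQuasiLocallyCoherent_iff hTE).2 ⟨?_, fun X Y K Z f i p _ _ hX hY hip ↦
      (hr i p hip (isFinitelyPresentable_kernel f hX hY)).1⟩
    let adj := Adjunction.ofIsLeftAdjoint E.ι
    have := Functor.IsFinitelyAccessible_iff_preservesFilteredColimitsOfSize.1
      (h.left.isFinitelyAccessible hTE adj)
    refine h.left.isLocallyFinitelyPresented hTE hC.isLocallyFinitelyPresented fun X ↦
      exists_directLimit_of_functor hC.isLocallyFinitelyPresented E.ι.rightAdjoint (fun B hB ↦ ?_)
        X (asIso (adj.unit.app X)).symm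
    obtain ⟨Y, p, hp⟩ := h.left.exists_isApproximation_counit adj B
    exact (h.left.isFinitelyPresentable_obj_iff hTE _).1 (hr _ _ hp hB).1
  · refine (h.right.isQuasiLocallyCoherent_iff h.finiteType).2
      ⟨?_, fun X Y K Z f i p hXT _ hX hY hip ↦ ?_⟩
    · let adj := Adjunction.ofIsRightAdjoint T.ι
      refine h.right.isLocallyFinitelyPresented h.finiteType hC.isLocallyFinitelyPresented fun X ↦
        exists_directLimit_of_functor hC.isLocallyFinitelyPresented T.ι.leftAdjoint
          (fun B hB ↦ adj.isCardinalPresentable_leftAdjoint_obj _ B) X (asIso (adj.counit.app X))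
    -- As a subobject of an object of `T`, the kernel already lies in `T`.
    · obtain ⟨e, -⟩ := (h.right.isApproximation_id
        (h.left.right_of_mono (kernel.ι f) hXT)).exists_iso_left h.right hip
      exact isFinitelyPresentable_of_iso e (isFinitelyPresentable_kernel f hX hY)
  · exact preservesColimit_extFunctorObj hC ((h.left.isFinitelyPresentable_obj_iff hTE P).2 hP) D
  · exact preservesColimit_extFunctorObj hC
      ((h.right.isFinitelyPresentable_obj_iff h.finiteType P).2 hP) D

end IsTTFTripleOfFiniteType

end TTF

end LCTTF

theorem theoremt {C : Type u} [Category.{v} C] [Abelian C] [IsGrothendieckAbelian.{v} C]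
    (E T F : ObjectProperty C) (hTTF : LCTTF.IsTTFTripleOfFiniteType.{v} E T F) :
    (LCTTF.IsLocallyCoherent.{v} C ↔ LCTTF.ConditionB.{v} E T) ∧
    (LCTTF.ConditionB.{v} E T → LCTTF.ConditionC.{v} E T) ∧
    (LCTTF.IsLocallyFinitelyPresented.{v} C →
      List.TFAE [LCTTF.IsLocallyCoherent.{v} C, LCTTF.ConditionB.{v} E T,
        LCTTF.ConditionC.{v} E T]) := by
  refine ⟨⟨hTTF.conditionB_of_isLocallyCoherent, hTTF.isLocallyCoherent_of_conditionB⟩,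
    hTTF.conditionC_of_conditionB, fun hC ↦ ?_⟩
  tfae_have 1 → 2 := hTTF.conditionB_of_isLocallyCoherent
  tfae_have 2 → 3 := hTTF.conditionC_of_conditionB
  tfae_have 3 → 1 := hTTF.isLocallyCoherent_of_conditionC hC
  tfae_finish
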